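/- **Setting.** All terms are taken up to $\alpha$-conversion. The target calculus is the asynchronous polyadic $\pi$-calculus with unary abstractions: processes $P ::= 0 \mid a(\tilde b).P \mid \bar a\langle\tilde b\rangle \mid P_1|P_2 \mid (\nu a)P \mid\, !a(\tilde b).P \mid F\langle a\rangle$, abstractions $F ::= (a)P$, agents being processes and abstractions, with the standard labelled transitions $\xrightarrow{\mu}$ (where $((a)P)\langle b\rangle$ has the transitions of $P\{b/a\}$); as usual, the bound names of an action that two processes have to match are fresh for both. $\Rightarrow$ is the reflexive transitive closure of $\xrightarrow{\tau}$; $\overset{\mu}{\Rightarrow}$ is $\Rightarrow\xrightarrow{\mu}\Rightarrow$; $\overset{\hat\mu}{\Rightarrow}$ is $\overset{\mu}{\Rightarrow}$ if $\mu\ne\tau$ and $\Rightarrow$ if $\mu=\tau$; $P\xrightarrow{\hat\mu}P'$ means $P\xrightarrow{\mu}P'$, or $\mu=\tau$ and $P=P'$. A context is an agent with (possibly several, indexed) holes; filling holes may capture names. It is guarded if its holes occur only underneath prefixes. A precongruence is a preorder on agents (relating processes to processes and abstractions to abstractions) preserved by all contexts; a congruence is a symmetric precongruence. The $\lambda$-variables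 are included in the names, with infinitely many names left over. An *encoding* is a map $[\![\cdot]\!]$ from $\lambda$-terms to abstractions that is *compositional*: $[\![x]\!]=T_x$, $[\![\lambda x.M]\!]=C^x_\lambda[[\![M]\!]]$, $[\![MN]\!]=C_{\rm app}[[\![M]\!],[\![N]\!]]$ for abstractions $T_x$, one-hole contexts $C^x_\lambda$ (the *abstraction contexts*) in which $x$ appears only as a bound name with a scope embracing the hole, and a two-hole context $C_{\rm app}$; and *uniform*: $[\![M\sigma]\!]=[\![M]\!]\sigma$ for every variable renaming $\sigma$, and the free names of $[\![M]\!]$ are free variables of $M$. Its *variable contexts* are the contexts $[\![x[\cdot]_1\cdots[\cdot]_n]\!]$, $n\ge 0$. A relation $\mathcal R$ on processes is an *expansion relation* if $P\,\mathcal R\,Q$ implies: if $P\xrightarrow{\mu}P'$ then $Q\overset{\mu}{\Rightarrow}Q'$ with $P'\,\mathcal R\,Q'$ for some $Q'$; and if $Q\xrightarrow{\mu}Q'$ then $P\xrightarrow{\hat\mu}P'$ with $P'\,\mathcal R\,Q'$ for some $P'$. Write $\ge$ for the converse of $\le$. The relation $\asymp$ *validates the up-to-$\le$-and-contexts technique*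 if $\mathcal R\subseteq{\asymp}$ for every symmetric relation $\mathcal R$ on processes such that, whenever $P\,\mathcal R\,Q$ and $P\xrightarrow{\mu}P'$, there are $Q'$ with $Q\overset{\hat\mu}{\Rightarrow}Q'$, tuples of processes $\tilde P,\tilde Q$ of the same length and a context $C$ with $P'\ge C[\tilde P]$, $Q'\ge C[\tilde Q]$ and, for each $i$, (1) $P_i\asymp Q_i$, or (2) $P_i\,\mathcal R\,Q_i$ and, if $[\cdot]_i$ occurs under an input in $C$, also $P_i\sigma\,\mathcal R\,Q_i\sigma$ for all name substitutions $\sigma$. An encoding and a relation $\mathcal R$ *validate rule $\beta$* if $[\![(\lambda x.M)N]\!]\,\mathcal R\,[\![M\{N/x\}]\!]$ for all $x,M,N$. Head reduction contracts the redex $(\lambda x.M_0)M_1$ of $\lambda\tilde x.(\lambda x.M_0)M_1\cdots M_n$; head normal forms are the terms $\lambda\tilde x.yM_1\cdots M_n$. A term is *unsolvable* if it has no head normal form; its order is the largest $n$ such that it head-reduces to a term $\lambda x_1\ldots x_n.N$, and $\infty$ if there is no largest such $n$. The *Lévy–Longo tree* of $M$ is $\top$ if $M$ is unsolvable of order $\infty$;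 $\lambda x_1\ldots x_n.\bot$ if $M$ is unsolvable of order $n<\infty$; and the tree with root $\lambda\tilde x.y$ and as children the Lévy–Longo trees of $M_1,\dots,M_n$ if $M$ has head normal form $\lambda\tilde x.yM_1\cdots M_n$. *Böhm trees* are defined in the same way, but with the tree $\bot$ for every unsolvable. $\Omega=(\lambda x.xx)(\lambda x.xx)$. An encoding and $\asymp$ are *complete* for Lévy–Longo (Böhm) trees if $[\![M]\!]\asymp[\![N]\!]$ for all $\lambda$-terms $M,N$ with the same Lévy–Longo (Böhm) tree. **Theorem (completeness conditions).** Let $[\![\cdot]\!]$ be an encoding of the $\lambda$-calculus into the $\pi$-calculus and $\asymp$ a congruence on $\pi$-agents. Suppose that there is a precongruence $\le$ on $\pi$-agents such that 1. ${\asymp}\supseteq{\ge}$; 2. $\le$ (on processes) is an expansion relation; 3. $\asymp$ validates the up-to-$\le$-and-contexts technique; 4. the variable contexts of $[\![\cdot]\!]$ are guarded; 5. $[\![\cdot]\!]$ and $\ge$ validate rule $\beta$; 6. $[\![M]\!]\asymp[\![\Omega]\!]$ whenever $M$ is an unsolvable of order $0$. Then: (i) if the abstraction contexts of $[\![\cdot]\!]$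 are guarded, then $[\![\cdot]\!]$ and $\asymp$ are complete for Lévy–Longo trees; (ii) if $[\![M]\!]\asymp[\![\Omega]\!]$ whenever $M$ is an unsolvable of order $\infty$, then $[\![\cdot]\!]$ and $\asymp$ are complete for Böhm trees. -/

import Mathlib

namespace TreesPi

/-! Names are natural numbers. Terms of both calculi are taken up to alpha-conversion: they are
represented with de Bruijn indices, a free name (or variable) `y` occurring below `k` binders being
written `y + k`. The named binding operations below are the ones used in all other definitions. -/

/-- `lift k f` is the renaming `f` of free names, carried below `k` binders. -/
def lift (k : ℕ) (f : ℕ → ℕ) (i : ℕ) : ℕ := if i < k then i else f (i - k) + k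

/-- The renaming that binds the (pairwise distinct) names `xs`: the `i`-th element of `xs` becomes
index `i`, and every other name is shifted. -/
def bindNames (xs : List ℕ) (y : ℕ) : ℕ := if y ∈ xs then xs.idxOf y else y + xs.length

/-- The simultaneous substitution of the names `bs` for the names `cs`. -/
def substNames (cs bs : List ℕ) (y : ℕ) : ℕ := ((cs.zip bs).lookup y).getD y

/-! ### The lambda-calculus -/

/-- Lambda-terms up to alpha-conversion. -/
inductive Lam : Type
  | var (x : ℕ)
  | lam (M : Lam)
  | app (M N : Lam)

namespace Lam

/-- Renaming of the free variables. -/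
def rename : (ℕ → ℕ) → Lam → Lam
  | f, var x => var (f x)
  | f, lam M => lam (rename (lift 1 f) M)
  | f, app M N => app (rename f M) (rename f N)

/-- A simultaneous substitution carried below a binder. -/
def up (s : ℕ → Lam) : ℕ → Lam
  | 0 => var 0
  | i + 1 => rename (· + 1) (s i)

/-- Capture-avoiding simultaneous substitution of terms for the free variables. -/
def subst : (ℕ → Lam) → Lam → Lam
  | s, var x => s x
  | s, lam M => lam (subst (up s) M)
  | s, app M N => app (subst s M) (subst s N)

/-- `inst M N` is the body `M` of an abstraction, with `N` for the bound variable. -/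
def inst (M N : Lam) : Lam :=
  subst (fun i => match i with
    | 0 => N
    | j + 1 => var j) M

/-- The free variables. -/
def fv : Lam → Set ℕ
  | var x => {x}
  | lam M => {x | x + 1 ∈ fv M}
  | app M N => fv M ∪ fv N

/-- The term `λ x. M`, where `x` is a variable that may be free in `M`. -/
def abs (x : ℕ) (M : Lam) : Lam := lam (rename (bindNames [x]) M)

/-- `n` nested abstractions, `λ x₁ … xₙ. M`. -/
def lams (n : ℕ) (M : Lam) : Lam := lam^[n] M

/-- The application `M N₁ … Nₖ`. -/
def apps (M : Lam) (Ns : List Lam) : Lam := Ns.foldl app M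

/-- The purely divergent term `(λ x. x x) (λ x. x x)`. -/
def Omega : Lam := app (lam (app (var 0) (var 0))) (lam (app (var 0) (var 0)))

/-- Call-by-name reduction: rules beta and mu. -/
inductive CbnStep : Lam → Lam → Prop
  | beta (M N : Lam) : CbnStep (app (lam M) N) (inst M N)
  | mu {M M' : Lam} (N : Lam) : CbnStep M M' → CbnStep (app M N) (app M' N)

/-- One step of head reduction: contraction of the head redex `(λ x. M₀) M₁` of a term
`λ x₁ … xₙ. (λ x. M₀) M₁ … Mₘ`. -/
inductive HeadStep : Lam → Lam → Prop
  | cbn {M M' : Lam} : CbnStep M M' → HeadStep M M'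
  | xi {M M' : Lam} : HeadStep M M' → HeadStep (lam M) (lam M')

/-- Head reduction. -/
def HeadRed : Lam → Lam → Prop := Relation.ReflTransGen HeadStep

/-- `M` has the head normal form `λ x₁ … xₙ. y M₁ … Mₘ` (`y` is an index: it is one of the `n`
bound variables if `y < n`, and the free variable `y - n` otherwise; the `Mᵢ` are below the `n`
binders). -/
def HasHnf (M : Lam) (h : ℕ × ℕ × List Lam) : Prop :=
  HeadRed M (lams h.1 (apps (var h.2.1) h.2.2))

def Solvable (M : Lam) : Prop := ∃ h, HasHnf M h

/-- The number of abstractions that head reduction uncovers; `⊤` if this number is unbounded. For an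
unsolvable term this is its order of unsolvability. -/
noncomputable def order (M : Lam) : ℕ∞ :=
  ⨆ k ∈ {k : ℕ | ∃ N, HeadRed M (lams k N)}, (k : ℕ∞)

/-- `M` is an unsolvable of order `k` (`⊤` is the order `∞`). -/
def UnsolvableOfOrder (M : Lam) (k : ℕ∞) : Prop := ¬ Solvable M ∧ order M = k

end Lam

/-! ### Trees -/

/-- Labels of tree nodes: `⊤`; `λ x₁ … xₙ. ⊥` (which is `⊥` for `n = 0`); `λ x₁ … xₙ. y`. -/
inductive Label : Type
  | top
  | bot (n : ℕ)
  | head (n y : ℕ)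

/-- A labelled tree: the label at each position, a position being the list of the child numbers that
lead to it from the root (`none` if the tree has no such position). -/
abbrev Tree : Type := List ℕ → Option Label

open Classical in
/-- The Lévy–Longo tree of a term (position first). -/
noncomputable def LTAt : List ℕ → Lam → Option Label
  | [], M =>
    if h : M.Solvable then some (.head h.choose.1 h.choose.2.1)
    else if M.order = ⊤ then some .top
    else some (.bot M.order.toNat)
  | i :: p, M =>
    if h : M.Solvable then h.choose.2.2[i]?.bind (fun N => LTAt p N) else none

open Classical in
/-- The Böhm tree of a term (position first). -/
noncomputable def BTAt : List ℕ → Lam → Option Label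
  | [], M =>
    if h : M.Solvable then some (.head h.choose.1 h.choose.2.1) else some (.bot 0)
  | i :: p, M =>
    if h : M.Solvable then h.choose.2.2[i]?.bind (fun N => BTAt p N) else none

/-- The Lévy–Longo tree of a term. -/
noncomputable def levyLongoTree (M : Lam) : Tree := fun p => LTAt p M

/-- The Böhm tree of a term. -/
noncomputable def boehmTree (M : Lam) : Tree := fun p => BTAt p M

/-! ### The asynchronous polyadic pi-calculus -/

/-- Processes up to alpha-conversion. `inp`, `rep` bind the indices below `k`; `nu` binds index `0`;
`app P b` is the application to `b` of the abstraction that binds index `0` in `P`. -/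
inductive Proc : Type
  | nil
  | inp (a k : ℕ) (P : Proc)
  | out (a : ℕ) (bs : List ℕ)
  | par (P Q : Proc)
  | nu (P : Proc)
  | rep (a k : ℕ) (P : Proc)
  | app (P : Proc) (b : ℕ)

/-- Abstractions; index `0` of the body is the parameter. -/
structure Abs : Type where
  body : Proc

namespace Proc

/-- Application of a name substitution. -/
def map : (ℕ → ℕ) → Proc → Proc
  | _, nil => nil
  | f, inp a k P => inp (f a) k (map (lift k f) P)
  | f, out a bs => out (f a) (bs.map f)
  | f, par P Q => par (map f P) (map f Q)
  | f, nu P => nu (map (lift 1 f) P)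
  | f, rep a k P => rep (f a) k (map (lift k f) P)
  | f, app P b => app (map (lift 1 f) P) (f b)

/-- The free names. -/
def fn : Proc → Set ℕ
  | nil => ∅
  | inp a k P => {a} ∪ {y | y + k ∈ fn P}
  | out a bs => {a} ∪ {y | y ∈ bs}
  | par P Q => fn P ∪ fn Q
  | nu P => {y | y + 1 ∈ fn P}
  | rep a k P => {a} ∪ {y | y + k ∈ fn P}
  | app P b => {y | y + 1 ∈ fn P} ∪ {b}

/-- The input `a(bs). P`. -/
def input (a : ℕ) (bs : List ℕ) (P : Proc) : Proc := inp a bs.length (map (bindNames bs) P)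

/-- The replicated input `! a(bs). P`. -/
def repInput (a : ℕ) (bs : List ℕ) (P : Proc) : Proc := rep a bs.length (map (bindNames bs) P)

/-- The restriction `(ν x) P`. -/
def res (x : ℕ) (P : Proc) : Proc := nu (map (bindNames [x]) P)

/-- The restriction `(ν x₁ … xₖ) P`. -/
def resList (xs : List ℕ) (P : Proc) : Proc := xs.foldr res P

end Proc

namespace Abs

/-- The abstraction `(x) P`. -/
def mk' (x : ℕ) (P : Proc) : Abs := ⟨P.map (bindNames [x])⟩

/-- The application `F⟨b⟩`. -/
def app (F : Abs) (b : ℕ) : Proc := .app F.body b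

/-- Application of a name substitution. -/
def map (f : ℕ → ℕ) (F : Abs) : Abs := ⟨F.body.map (lift 1 f)⟩

/-- The free names. -/
def fn (F : Abs) : Set ℕ := {y | y + 1 ∈ F.body.fn}

end Abs

/-- Actions: `τ`, the input `a(bs)`, and the output `(ν ds) a⟨bs⟩` (the order of the extruded names
`ds` is immaterial). -/
inductive Act : Type
  | tau
  | inp (a : ℕ) (bs : List ℕ)
  | out (ds : Finset ℕ) (a : ℕ) (bs : List ℕ)

namespace Act

/-- The bound names of an action. -/
def bn : Act → Set ℕ
  | tau => ∅
  | inp _ bs => {y | y ∈ bs}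
  | out ds _ _ => ↑ds

/-- All names of an action. -/
def names : Act → Set ℕ
  | tau => ∅
  | inp a bs => {a} ∪ {y | y ∈ bs}
  | out ds a bs => ↑ds ∪ {a} ∪ {y | y ∈ bs}

end Act

/-- The transition relation. -/
inductive Trans : Proc → Act → Proc → Prop
  | inp (a : ℕ) (bs : List ℕ) (P : Proc) : bs.Nodup → Trans (.input a bs P) (.inp a bs) P
  | rep (a : ℕ) (bs : List ℕ) (P : Proc) : bs.Nodup → a ∉ bs →
      Trans (.repInput a bs P) (.inp a bs) (.par P (.repInput a bs P))
  | out (a : ℕ) (bs : List ℕ) : Trans (.out a bs) (.out ∅ a bs) .nil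
  | parL {P P' : Proc} {μ : Act} (Q : Proc) : Trans P μ P' → Disjoint μ.bn Q.fn →
      Trans (.par P Q) μ (.par P' Q)
  | parR {Q Q' : Proc} {μ : Act} (P : Proc) : Trans Q μ Q' → Disjoint μ.bn P.fn →
      Trans (.par P Q) μ (.par P Q')
  | comL {P P' Q Q' : Proc} {a : ℕ} {bs cs ds : List ℕ} :
      Trans P (.inp a cs) P' → Trans Q (.out ds.toFinset a bs) Q' → ds.Nodup →
      cs.length = bs.length → Disjoint {y | y ∈ ds} P.fn →
      Trans (.par P Q) .tau (.resList ds (.par (P'.map (substNames cs bs)) Q'))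
  | comR {P P' Q Q' : Proc} {a : ℕ} {bs cs ds : List ℕ} :
      Trans P (.out ds.toFinset a bs) P' → Trans Q (.inp a cs) Q' → ds.Nodup →
      cs.length = bs.length → Disjoint {y | y ∈ ds} Q.fn →
      Trans (.par P Q) .tau (.resList ds (.par P' (Q'.map (substNames cs bs))))
  | res {P P' : Proc} {μ : Act} (x : ℕ) : Trans P μ P' → x ∉ μ.names →
      Trans (.res x P) μ (.res x P')
  | opn {P P' : Proc} {ds : Finset ℕ} {a : ℕ} {bs : List ℕ} (c : ℕ) :
      Trans P (.out ds a bs) P' → c ∈ bs → c ∉ ds → a ≠ c →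
      Trans (.res c P) (.out (insert c ds) a bs) P'
  | app {P P' : Proc} {μ : Act} (x b : ℕ) : Trans (P.map (substNames [x] [b])) μ P' →
      Trans ((Abs.mk' x P).app b) μ P'

/-- Reflexive transitive closure of the `τ` transitions. -/
def TauStar : Proc → Proc → Prop := Relation.ReflTransGen (fun P Q => Trans P .tau Q)

/-- The weak transition: `τ` steps, one `μ` step, `τ` steps. -/
def Weak (P : Proc) (μ : Act) (Q : Proc) : Prop :=
  ∃ P₁ P₂, TauStar P P₁ ∧ Trans P₁ μ P₂ ∧ TauStar P₂ Q

/-- The weak transition, where a `τ` may be matched by no step at all. -/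
def WeakHat (P : Proc) (μ : Act) (Q : Proc) : Prop :=
  (μ = .tau ∧ TauStar P Q) ∨ (μ ≠ .tau ∧ Weak P μ Q)

/-- The strong transition, where a `τ` may be matched by no step at all. -/
def StepHat (P : Proc) (μ : Act) (Q : Proc) : Prop := Trans P μ Q ∨ (μ = .tau ∧ P = Q)

/-- The usual convention on the bound names of an action that two processes have to match. -/
def FreshFor (μ : Act) (P Q : Proc) : Prop := Disjoint μ.bn (P.fn ∪ Q.fn)

/-! ### Contexts -/

/-- Process contexts with `m` process holes and `n` abstraction holes. A hole may occur any number
of times; binders of a context are named, and capture the names of the agents put in the holes. -/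
inductive PCtx (m n : ℕ) : Type
  /-- a process without holes -/
  | const (P : Proc)
  /-- the process hole `[·]ᵢ` -/
  | hole (i : Fin m)
  /-- the application `[·]ⱼ⟨b⟩` of an abstraction hole -/
  | holeApp (j : Fin n) (b : ℕ)
  | input (a : ℕ) (bs : List ℕ) (C : PCtx m n)
  | par (C D : PCtx m n)
  | res (x : ℕ) (C : PCtx m n)
  | repInput (a : ℕ) (bs : List ℕ) (C : PCtx m n)
  /-- the application `((x) C)⟨b⟩` -/
  | absApp (x : ℕ) (C : PCtx m n) (b : ℕ)

/-- Abstraction contexts. -/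
inductive FCtx (m n : ℕ) : Type
  /-- an abstraction without holes -/
  | const (F : Abs)
  /-- the abstraction hole `[·]ⱼ` -/
  | hole (j : Fin n)
  /-- the abstraction `(x) C` -/
  | abs (x : ℕ) (C : PCtx m n)

namespace PCtx

variable {m n k : ℕ}

/-- The process obtained by filling the holes. -/
def fill (Ps : Fin m → Proc) (Fs : Fin n → Abs) : PCtx m n → Proc
  | const P => P
  | hole i => Ps i
  | holeApp j b => (Fs j).app b
  | input a bs C => .input a bs (fill Ps Fs C)
  | par C D => .par (fill Ps Fs C) (fill Ps Fs D)
  | res x C => .res x (fill Ps Fs C)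
  | repInput a bs C => .repInput a bs (fill Ps Fs C)
  | absApp x C b => (Abs.mk' x (fill Ps Fs C)).app b

/-- The holes occur only underneath a prefix. -/
def Guarded : PCtx m n → Prop
  | const _ => True
  | hole _ => False
  | holeApp _ _ => False
  | input _ _ _ => True
  | par C D => Guarded C ∧ Guarded D
  | res _ C => Guarded C
  | repInput _ _ _ => True
  | absApp _ C _ => Guarded C

/-- The process hole `i` occurs. -/
def Occurs (i : Fin m) : PCtx m n → Prop
  | const _ => False
  | hole i' => i = i'
  | holeApp _ _ => False
  | input _ _ C => Occurs i C
  | par C D => Occurs i C ∨ Occurs i D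
  | res _ C => Occurs i C
  | repInput _ _ C => Occurs i C
  | absApp _ C _ => Occurs i C

/-- The process hole `i` occurs under an input. -/
def OccursUnderInput (i : Fin m) : PCtx m n → Prop
  | const _ => False
  | hole _ => False
  | holeApp _ _ => False
  | input _ _ C => Occurs i C
  | par C D => OccursUnderInput i C ∨ OccursUnderInput i D
  | res _ C => OccursUnderInput i C
  | repInput _ _ C => Occurs i C
  | absApp _ C _ => OccursUnderInput i C

/-- The names that occur free in the context. -/
def fn : PCtx m n → Set ℕ
  | const P => P.fn
  | hole _ => ∅
  | holeApp _ b => {b}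
  | input a bs C => {a} ∪ (fn C \ {y | y ∈ bs})
  | par C D => fn C ∪ fn D
  | res x C => fn C \ {x}
  | repInput a bs C => {a} ∪ (fn C \ {y | y ∈ bs})
  | absApp x C b => (fn C \ {x}) ∪ {b}

/-- Every hole is in the scope of a binder of the name `z`. -/
def HolesInScope (z : ℕ) : PCtx m n → Prop
  | const _ => True
  | hole _ => False
  | holeApp _ _ => False
  | input _ bs C => z ∈ bs ∨ HolesInScope z C
  | par C D => HolesInScope z C ∧ HolesInScope z D
  | res x C => z = x ∨ HolesInScope z C
  | repInput _ bs C => z ∈ bs ∨ HolesInScope z C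
  | absApp x C _ => z = x ∨ HolesInScope z C

/-- The application of an abstraction context to a name. -/
def ofApp (C : FCtx m n) (b : ℕ) : PCtx m n :=
  match C with
  | .const F => .const (F.app b)
  | .hole j => .holeApp j b
  | .abs x C => .absApp x C b

/-- Composition: abstraction contexts are put in the abstraction holes. -/
def plug (Gs : Fin k → FCtx m n) : PCtx m k → PCtx m n
  | const P => const P
  | hole i => hole i
  | holeApp j b => ofApp (Gs j) b
  | input a bs C => input a bs (plug Gs C)
  | par C D => par (plug Gs C) (plug Gs D)
  | res x C => res x (plug Gs C)
  | repInput a bs C => repInput a bs (plug Gs C)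
  | absApp x C b => absApp x (plug Gs C) b

end PCtx

namespace FCtx

variable {m n k : ℕ}

/-- The abstraction obtained by filling the holes. -/
def fill (Ps : Fin m → Proc) (Fs : Fin n → Abs) : FCtx m n → Abs
  | const F => F
  | hole j => Fs j
  | abs x C => Abs.mk' x (C.fill Ps Fs)

/-- The holes occur only underneath a prefix. -/
def Guarded : FCtx m n → Prop
  | const _ => True
  | hole _ => False
  | abs _ C => C.Guarded

/-- The names that occur free in the context. -/
def fn : FCtx m n → Set ℕ
  | const F => F.fn
  | hole _ => ∅
  | abs x C => C.fn \ {x}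

/-- Every hole is in the scope of a binder of the name `z`. -/
def HolesInScope (z : ℕ) : FCtx m n → Prop
  | const _ => True
  | hole _ => False
  | abs x C => z = x ∨ C.HolesInScope z

/-- Composition: abstraction contexts are put in the abstraction holes. -/
def plug (Gs : Fin k → FCtx m n) : FCtx m k → FCtx m n
  | const F => const F
  | hole j => Gs j
  | abs x C => abs x (C.plug Gs)

end FCtx

/-! ### Relations on agents -/

/-- A relation on agents: it relates processes to processes and abstractions to abstractions. -/
structure AgentRel : Type where
  proc : Proc → Proc → Prop
  abs : Abs → Abs → Prop

namespace AgentRel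

/-- The converse relation. -/
def inv (R : AgentRel) : AgentRel := ⟨fun P Q => R.proc Q P, fun F G => R.abs G F⟩

/-- Inclusion of relations. -/
def Sub (R S : AgentRel) : Prop :=
  (∀ P Q, R.proc P Q → S.proc P Q) ∧ (∀ F G, R.abs F G → S.abs F G)

/-- A precongruence: a preorder that is preserved by all contexts. -/
structure IsPrecongruence (R : AgentRel) : Prop where
  refl_proc : ∀ P, R.proc P P
  refl_abs : ∀ F, R.abs F F
  trans_proc : ∀ P Q S, R.proc P Q → R.proc Q S → R.proc P S
  trans_abs : ∀ F G H, R.abs F G → R.abs G H → R.abs F H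
  pctx : ∀ (m n : ℕ) (C : PCtx m n) (Ps Qs : Fin m → Proc) (Fs Gs : Fin n → Abs),
    (∀ i, R.proc (Ps i) (Qs i)) → (∀ j, R.abs (Fs j) (Gs j)) →
      R.proc (C.fill Ps Fs) (C.fill Qs Gs)
  fctx : ∀ (m n : ℕ) (C : FCtx m n) (Ps Qs : Fin m → Proc) (Fs Gs : Fin n → Abs),
    (∀ i, R.proc (Ps i) (Qs i)) → (∀ j, R.abs (Fs j) (Gs j)) →
      R.abs (C.fill Ps Fs) (C.fill Qs Gs)

/-- A congruence: a symmetric precongruence. -/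
structure IsCongruence (R : AgentRel) : Prop extends IsPrecongruence R where
  symm_proc : ∀ P Q, R.proc P Q → R.proc Q P
  symm_abs : ∀ F G, R.abs F G → R.abs G F

end AgentRel

/-- Expansion relations on processes. -/
def IsExpansion (R : Proc → Proc → Prop) : Prop :=
  ∀ P Q, R P Q → ∀ μ, FreshFor μ P Q →
    (∀ P', Trans P μ P' → ∃ Q', Weak Q μ Q' ∧ R P' Q') ∧
    (∀ Q', Trans Q μ Q' → ∃ P', StepHat P μ P' ∧ R P' Q')

/-- `R` is a candidate for the up-to-`le`-and-contexts technique for `eqv`. -/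
def IsUpToCandidate (eqv le : AgentRel) (R : Proc → Proc → Prop) : Prop :=
  ∀ P Q, R P Q → ∀ μ P', FreshFor μ P Q → Trans P μ P' →
    ∃ Q', WeakHat Q μ Q' ∧
      ∃ (n : ℕ) (Ps Qs : Fin n → Proc) (C : PCtx n 0),
        le.inv.proc P' (C.fill Ps Fin.elim0) ∧ le.inv.proc Q' (C.fill Qs Fin.elim0) ∧
        ∀ i, eqv.proc (Ps i) (Qs i) ∨
          (R (Ps i) (Qs i) ∧
            (C.OccursUnderInput i → ∀ s : ℕ → ℕ, R ((Ps i).map s) ((Qs i).map s)))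

/-- `eqv` validates the up-to-`le`-and-contexts technique. -/
def ValidatesUpTo (eqv le : AgentRel) : Prop :=
  ∀ R : Proc → Proc → Prop, (∀ P Q, R P Q → R Q P) → IsUpToCandidate eqv le R →
    ∀ P Q, R P Q → eqv.proc P Q

/-! ### Encodings -/

/-- The lambda-variables are included in the names: they are the even names. Infinitely many names
are not lambda-variables. -/
def varName (x : ℕ) : ℕ := 2 * x

/-- A variable renaming, seen as a name substitution. -/
def nameSubst (s : ℕ → ℕ) (a : ℕ) : ℕ := if a % 2 = 0 then varName (s (a / 2)) else a

/-- A compositional and uniform encoding of the lambda-calculus into the pi-calculus. -/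
structure Encoding : Type where
  /-- the encoding of terms (which are taken up to alpha-conversion) -/
  enc : Lam → Abs
  /-- the encoding of variables -/
  varAbs : ℕ → Abs
  /-- the abstraction contexts -/
  lamCtx : ℕ → FCtx 0 1
  /-- the application context -/
  appCtx : FCtx 0 2
  enc_var : ∀ x, enc (.var x) = varAbs x
  enc_abs : ∀ x M, enc (.abs x M) = (lamCtx x).fill Fin.elim0 ![enc M]
  enc_app : ∀ M N, enc (.app M N) = appCtx.fill Fin.elim0 ![enc M, enc N]
  /-- `x` appears in its abstraction context only as a bound name whose scope embraces the hole -/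
  lamCtx_fn : ∀ x, varName x ∉ (lamCtx x).fn
  lamCtx_scope : ∀ x, (lamCtx x).HolesInScope (varName x)
  /-- uniformity -/
  enc_rename : ∀ (s : ℕ → ℕ) (M : Lam), enc (M.rename s) = (enc M).map (nameSubst s)
  enc_fn : ∀ M, (enc M).fn ⊆ varName '' M.fv

/-- The variable context `⟦x [·]₁ … [·]ₙ⟧`. -/
def Encoding.varCtx (E : Encoding) (x : ℕ) : (n : ℕ) → FCtx 0 n
  | 0 => .const (E.varAbs x)
  | n + 1 =>
    E.appCtx.plug ![(E.varCtx x n).plug (fun j => .hole j.castSucc), .hole (Fin.last n)]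

/-- `E` and `R` validate rule beta. -/
def ValidatesBeta (E : Encoding) (R : AgentRel) : Prop :=
  ∀ M N : Lam, R.abs (E.enc (.app (.lam M) N)) (E.enc (.inst M N))

/-- `E` and `R` are complete for the trees `T`. -/
def CompleteFor (E : Encoding) (R : AgentRel) (T : Lam → Tree) : Prop :=
  ∀ M N : Lam, T M = T N → R.abs (E.enc M) (E.enc N)

end TreesPi

open TreesPi

/-! Terms with the same tree head-reduce to terms whose encodings share one guarded outer context,
with encodings of same-tree terms in its holes. For head normal forms with a common head, this is a
variable context wrapped in abstraction contexts; for Lévy–Longo trees and unsolvables of order ∞,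
it is a guarded abstraction context. Rule β and precongruence turn the head reductions into
expansions. The other unsolvables are equated directly: one of order n is congruent to λx₁…xₙ.Ω, and
in the Böhm case λx.Ω ≍ Ω follows by comparing both with `Ogre`, a term of order ∞ that reduces to
an abstraction of itself.

The candidate for the up-to technique is `GuardedExpansion`: P and Q expand C[P̃] and C[Q̃], where C
is guarded and the holes contain same-tree encodings. When P moves, the expansion makes C[P̃] move
or stay. A guarded context moves on its own (`Trans.matched`), so C[Q̃] makes the same move into the
same derived context, and Q follows weakly. The derived context need not be guarded any more, but
the contents of its holes are congruent or again in the candidate, by the first paragraph. That is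
what `GuardedExpansion.isUpToCandidate` and `Encoding.eqv_of_guardedClosure` exploit.

Neither ≍ nor ≤ is assumed closed under name substitution. Applying the abstraction of a name yields
a process with the transitions of the substitution instance (`SameTrans`), but a different process.
The up-to technique puts `SameTrans` inside ≍, which makes ≍ closed under substitution. For ≤ no
such inclusion is available, so expansions are used up to `SameTrans` at both ends (`ExpandsTo`).
The same device clears the bound names of an action from intermediate processes
(`exists_le_collapse`). -/

namespace TreesPi

/-! ### Names and renamings -/

/-- The renaming that gives the names `bs` to the indices below `bs.length`; a left inverse of
`bindNames bs`. -/
def unbindNames (bs : List ℕ) (i : ℕ) : ℕ := (bs[i]?).getD (i - bs.length)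

theorem unbindNames_of_lt {bs : List ℕ} {i : ℕ} (h : i < bs.length) : unbindNames bs i = bs[i] := by
  simp [unbindNames, h]

theorem unbindNames_of_le {bs : List ℕ} {i : ℕ} (h : bs.length ≤ i) :
    unbindNames bs i = i - bs.length := by
  simp [unbindNames, h]

/-- The basic identity for changing bound names: closing over `bs`, renaming below the binder by `f`
and reopening with new names amounts to one renaming `h`, which agrees with `f` off `bs`. -/
theorem unbindNames_lift_bindNames {bs : List ℕ} {f h : ℕ → ℕ} (hf : ∀ y, y ∉ bs → h y = f y)
    (y : ℕ) : unbindNames (bs.map h) (lift bs.length f (bindNames bs y)) = h y := by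
  unfold bindNames
  split_ifs with hy
  · have hi : bs.idxOf y < bs.length := List.idxOf_lt_length_of_mem hy
    rw [lift, if_pos hi, unbindNames_of_lt (by simpa using hi)]
    simp
  · rw [lift, if_neg (by omega), unbindNames_of_le (by simp)]
    simp [hf y hy]

theorem lift_id (k : ℕ) : lift k id = id := by
  funext i; simp only [lift, id]; split_ifs <;> omega

/-- The excluded indices are those of free names belonging to `bs`, which closing the binder again
would capture. -/
theorem bindNames_unbindNames {bs : List ℕ} (hb : bs.Nodup) {i : ℕ}
    (hi : ∀ y ∈ bs, y + bs.length ≠ i) : bindNames bs (unbindNames bs i) = i := by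
  by_cases h : i < bs.length
  · rw [unbindNames_of_lt h, bindNames, if_pos (List.getElem_mem h), hb.idxOf_getElem]
  · rw [unbindNames_of_le (by omega), bindNames, if_neg]
    · omega
    · intro hm; exact hi _ hm (by omega)

theorem bindNames_eq_add {bs : List ℕ} {y z : ℕ} (h : bindNames bs z = y + bs.length) :
    z ∉ bs ∧ z = y := by
  unfold bindNames at h
  split_ifs at h with hz
  · have := List.idxOf_lt_length_of_mem hz; omega
  · exact ⟨hz, by omega⟩

theorem bindNames_map {bs : List ℕ} {f h : ℕ → ℕ} (hb : bs.Nodup)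
    (hi : ∀ x ∈ bs, ∀ y ∈ bs, h x = h y → x = y) (hf : ∀ y, y ∉ bs → h y = f y) {y : ℕ}
    (hy : y ∉ bs → f y ∉ bs.map h) :
    bindNames (bs.map h) (h y) = lift bs.length f (bindNames bs y) := by
  have hn : (bs.map h).Nodup := hb.map_on hi
  rw [← unbindNames_lift_bindNames hf y, bindNames_unbindNames hn]
  intro z hz he
  simp only [List.length_map] at he
  by_cases hyb : y ∈ bs
  · have hlt : bs.idxOf y < bs.length := List.idxOf_lt_length_of_mem hyb
    rw [bindNames, if_pos hyb, lift, if_pos hlt] at he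
    omega
  · rw [bindNames, if_neg hyb, lift, if_neg (by omega)] at he
    have : z = f y := by simpa using he
    exact hy hyb (this ▸ hz)

theorem lift_comp (k : ℕ) (f g : ℕ → ℕ) : lift k (f ∘ g) = lift k f ∘ lift k g := by
  funext i; simp only [lift, Function.comp]; split_ifs <;> first | rfl | omega | simp_all

theorem lift_add (k : ℕ) (f : ℕ → ℕ) (y : ℕ) : lift k f (y + k) = f y + k := by
  simp [lift]

theorem setOf_add_mem_image_lift (k : ℕ) (f : ℕ → ℕ) (S : Set ℕ) :
    {y | y + k ∈ lift k f '' S} = f '' {y | y + k ∈ S} := by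
  ext y
  simp only [Set.mem_image, Set.mem_ofPred_eq]
  constructor
  · rintro ⟨z, hz, he⟩
    by_cases hk : z < k
    · rw [lift, if_pos hk] at he; omega
    · rw [lift, if_neg hk] at he
      exact ⟨z - k, by rwa [Nat.sub_add_cancel (by omega)], by omega⟩
  · rintro ⟨z, hz, rfl⟩
    exact ⟨z + k, hz, lift_add k f z⟩

theorem substNames_nil (bs : List ℕ) (y : ℕ) : substNames [] bs y = y := by simp [substNames]

theorem substNames_cons (c b : ℕ) (cs bs : List ℕ) (y : ℕ) :
    substNames (c :: cs) (b :: bs) y = if y = c then b else substNames cs bs y := by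
  simp only [substNames, List.zip_cons_cons, List.lookup_cons]
  by_cases h : y = c
  · simp [h]
  · simp [h, beq_eq_false_iff_ne.mpr h]

theorem substNames_of_notMem {cs bs : List ℕ} {y : ℕ} (h : y ∉ cs) : substNames cs bs y = y := by
  induction cs generalizing bs with
  | nil => exact substNames_nil _ _
  | cons c cs ih =>
    cases bs with
    | nil => simp [substNames]
    | cons b bs =>
      simp only [List.mem_cons, not_or] at h
      rw [substNames_cons, if_neg h.1, ih h.2]

/-- The lookup returns the first match, so `g` only has to keep the image of `y` apart from those of
the other names in `cs`. -/
theorem substNames_map {cs bs : List ℕ} {g h : ℕ → ℕ} (hl : cs.length = bs.length) {y : ℕ}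
    (hy : y ∈ cs) (hi : ∀ x ∈ cs, g y = g x → y = x) :
    substNames (cs.map g) (bs.map h) (g y) = h (substNames cs bs y) := by
  induction cs generalizing bs with
  | nil => simp at hy
  | cons c cs ih =>
    cases bs with
    | nil => simp at hl
    | cons b bs =>
      rw [List.map_cons, List.map_cons, substNames_cons, substNames_cons]
      by_cases h1 : y = c
      · simp [h1]
      · rw [if_neg h1, if_neg (fun h2 => h1 (hi c (by simp) h2))]
        exact ih (by simpa using hl) (by simpa [h1] using hy)
          (fun x hx => hi x (List.mem_cons_of_mem _ hx))

theorem substNames_singleton (x b y : ℕ) : substNames [x] [b] y = if y = x then b else y := by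
  rw [substNames_cons, substNames_nil]

theorem unbindNames_lift_bindNames_singleton (f : ℕ → ℕ) (x b y : ℕ) :
    unbindNames [b] (lift 1 f (bindNames [x] y)) = if y = x then b else f y := by
  have := unbindNames_lift_bindNames (bs := [x]) (f := f) (h := Function.update f x b)
    (fun z hz => by simp at hz; simp [hz]) y
  simpa [Function.update_apply] using this

theorem exists_fresh {S : Set ℕ} (h : S.Finite) : ∃ N, ∀ y ∈ S, y < N := by
  obtain ⟨N, hN⟩ := h.bddAbove
  exact ⟨N + 1, fun y hy => Nat.lt_succ_of_le (hN hy)⟩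

namespace Proc

theorem map_map (P : Proc) : ∀ f g : ℕ → ℕ, (P.map g).map f = P.map (f ∘ g) := by
  induction P <;> intro f g <;> simp_all [map, lift_comp]

theorem map_congr {P : Proc} : ∀ {f g : ℕ → ℕ}, (∀ y ∈ P.fn, f y = g y) → P.map f = P.map g := by
  have key : ∀ (P : Proc) (k : ℕ) (f g : ℕ → ℕ), (∀ y, y + k ∈ P.fn → f y = g y) →
      ∀ y ∈ P.fn, lift k f y = lift k g y := by
    intro P k f g h y hy
    simp only [lift]
    split_ifs with hk
    · rfl
    · rw [h]; rwa [Nat.sub_add_cancel (by omega)]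
  induction P with
  | nil => intros; rfl
  | inp a k P ih =>
    intro f g h
    simp only [map]
    rw [h a (by simp [fn]), ih (key P k f g fun y hy => h y (by simp [fn, hy]))]
  | out a bs =>
    intro f g h
    simp only [map]
    rw [h a (by simp [fn]), List.map_congr_left fun y hy => h y (by simp [fn, hy])]
  | par P Q ihP ihQ =>
    intro f g h
    simp only [map]
    rw [ihP fun y hy => h y (by simp [fn, hy]), ihQ fun y hy => h y (by simp [fn, hy])]
  | nu P ih =>
    intro f g h
    simp only [map]
    rw [ih (key P 1 f g fun y hy => h y (by simp [fn, hy]))]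
  | rep a k P ih =>
    intro f g h
    simp only [map]
    rw [h a (by simp [fn]), ih (key P k f g fun y hy => h y (by simp [fn, hy]))]
  | app P b ih =>
    intro f g h
    simp only [map]
    rw [h b (by simp [fn]), ih (key P 1 f g fun y hy => h y (by simp [fn, hy]))]

theorem map_id (P : Proc) : P.map id = P := by
  induction P <;> simp_all [map, lift_id]

theorem map_eq_self {P : Proc} {f : ℕ → ℕ} (h : ∀ y ∈ P.fn, f y = y) : P.map f = P :=
  (map_congr h).trans P.map_id

theorem fn_map (P : Proc) : ∀ f : ℕ → ℕ, (P.map f).fn = f '' P.fn := by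
  induction P with
  | nil => simp [map, fn]
  | inp a k P ih =>
    intro f
    simp only [map, fn, ih, setOf_add_mem_image_lift, Set.image_union, Set.image_singleton]
  | out a bs =>
    intro f
    simp only [map, fn, Set.image_union, Set.image_singleton, List.mem_map]
    rfl
  | par P Q ihP ihQ => intro f; simp only [map, fn, ihP, ihQ, Set.image_union]
  | nu P ih => intro f; simp only [map, fn, ih, setOf_add_mem_image_lift]
  | rep a k P ih =>
    intro f
    simp only [map, fn, ih, setOf_add_mem_image_lift, Set.image_union, Set.image_singleton]
  | app P b ih =>
    intro f
    simp only [map, fn, ih, setOf_add_mem_image_lift, Set.image_union, Set.image_singleton]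

theorem fn_finite (P : Proc) : P.fn.Finite := by
  have key : ∀ (S : Set ℕ) (k : ℕ), S.Finite → {y | y + k ∈ S}.Finite := fun S k h =>
    h.preimage (Function.Injective.injOn fun a b hab => by simpa using hab)
  induction P with
  | nil => exact Set.finite_empty
  | inp a k P ih => exact (Set.finite_singleton a).union (key _ _ ih)
  | out a bs => exact (Set.finite_singleton a).union (List.finite_toSet bs)
  | par P Q ihP ihQ => exact ihP.union ihQ
  | nu P ih => exact key _ _ ih
  | rep a k P ih => exact (Set.finite_singleton a).union (key _ _ ih)
  | app P b ih => exact (key _ _ ih).union (Set.finite_singleton b)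

theorem map_bindNames_map_unbindNames {bs : List ℕ} (hb : bs.Nodup) {P : Proc}
    (h : ∀ y ∈ bs, y + bs.length ∉ P.fn) :
    (P.map (unbindNames bs)).map (bindNames bs) = P := by
  rw [map_map]
  exact map_eq_self fun i hi =>
    bindNames_unbindNames hb fun y hy he => h y hy (he ▸ hi)

theorem inp_eq_input (a : ℕ) {bs : List ℕ} (hb : bs.Nodup) {P : Proc}
    (h : ∀ y ∈ bs, y + bs.length ∉ P.fn) :
    inp a bs.length P = input a bs (P.map (unbindNames bs)) := by
  rw [input, map_bindNames_map_unbindNames hb h]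

theorem rep_eq_repInput (a : ℕ) {bs : List ℕ} (hb : bs.Nodup) {P : Proc}
    (h : ∀ y ∈ bs, y + bs.length ∉ P.fn) :
    rep a bs.length P = repInput a bs (P.map (unbindNames bs)) := by
  rw [repInput, map_bindNames_map_unbindNames hb h]

theorem nu_eq_res {x : ℕ} {P : Proc} (h : x ∉ (nu P).fn) :
    nu P = res x (P.map (unbindNames [x])) := by
  rw [res, map_bindNames_map_unbindNames (List.nodup_singleton x)]
  intro y hy
  simp only [List.mem_singleton] at hy
  subst hy
  exact h

theorem fn_map_unbindNames (P : Proc) (bs : List ℕ) :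
    (P.map (unbindNames bs)).fn ⊆ {y | y ∈ bs} ∪ {y | y + bs.length ∈ P.fn} := by
  rw [fn_map]
  rintro _ ⟨i, hi, rfl⟩
  by_cases h : i < bs.length
  · left; rw [unbindNames_of_lt h]; exact List.getElem_mem h
  · right; rw [unbindNames_of_le (by omega)]
    simpa [Nat.sub_add_cancel (not_lt.mp h)] using hi

theorem setOf_add_mem_fn_map_bindNames (P : Proc) (bs : List ℕ) :
    {y | y + bs.length ∈ (P.map (bindNames bs)).fn} = P.fn \ {y | y ∈ bs} := by
  ext y
  simp only [fn_map, Set.mem_ofPred_eq, Set.mem_image, Set.mem_sdiff]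
  constructor
  · rintro ⟨z, hz, he⟩
    obtain ⟨h1, rfl⟩ := bindNames_eq_add he
    exact ⟨hz, h1⟩
  · rintro ⟨h1, h2⟩
    exact ⟨y, h1, by simp [bindNames, h2]⟩

theorem fn_res (x : ℕ) (P : Proc) : (res x P).fn = P.fn \ {x} := by
  have := setOf_add_mem_fn_map_bindNames P [x]
  simpa [res, fn] using this

theorem fn_input (a : ℕ) (bs : List ℕ) (P : Proc) :
    (input a bs P).fn = {a} ∪ (P.fn \ {y | y ∈ bs}) := by
  rw [input, fn, setOf_add_mem_fn_map_bindNames]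

theorem fn_repInput (a : ℕ) (bs : List ℕ) (P : Proc) :
    (repInput a bs P).fn = {a} ∪ (P.fn \ {y | y ∈ bs}) := by
  rw [repInput, fn, setOf_add_mem_fn_map_bindNames]

theorem fn_mk'_app (x : ℕ) (P : Proc) (b : ℕ) :
    ((Abs.mk' x P).app b).fn = P.fn \ {x} ∪ {b} := by
  have := setOf_add_mem_fn_map_bindNames P [x]
  simp only [Abs.mk', Abs.app, fn]
  simp only [List.length_singleton, List.mem_singleton] at this
  rw [this]; rfl

theorem fn_resList (xs : List ℕ) (P : Proc) : (resList xs P).fn = P.fn \ {y | y ∈ xs} := by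
  induction xs with
  | nil => simp [resList]
  | cons x xs ih =>
    rw [resList, List.foldr_cons, fn_res]
    rw [resList] at ih
    rw [ih]
    ext y; simp; tauto

/-- Renaming under a restriction with a change of the bound name to `h x`; the second hypothesis
says that no renamed free name is captured. -/
theorem map_res {x : ℕ} {f h : ℕ → ℕ} {P : Proc} (hf : ∀ y, y ≠ x → h y = f y)
    (hx : ∀ y ∈ P.fn, y ≠ x → f y ≠ h x) : (res x P).map f = res (h x) (P.map h) := by
  simp only [res, map, map_map]
  congr 1
  refine map_congr fun y hy => ?_
  have := bindNames_map (bs := [x]) (f := f) (h := h) (y := y) (List.nodup_singleton x)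
    (by simp) (by simpa using hf) (by simpa using hx y hy)
  simpa using this.symm

theorem map_resList {xs : List ℕ} {f h : ℕ → ℕ} {P : Proc} (hn : xs.Nodup)
    (hi : ∀ x ∈ xs, ∀ y ∈ xs, h x = h y → x = y) (hf : ∀ y, y ∉ xs → h y = f y)
    (hx : ∀ y ∈ P.fn, y ∉ xs → f y ∉ xs.map h) :
    (resList xs P).map f = resList (xs.map h) (P.map h) := by
  induction xs generalizing f with
  | nil =>
    simp only [resList, List.foldr_nil, List.map_nil]
    rw [show h = f from funext fun y => hf y (by simp)]
  | cons x xs ih =>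
    have hn' := List.nodup_cons.mp hn
    change (res x (resList xs P)).map f = res (h x) (resList (xs.map h) (P.map h))
    -- Below the outermost restriction `x` is a free name, already sent to its new value.
    rw [← ih (f := Function.update f x (h x)) hn'.2
      (fun y hy z hz => hi y (List.mem_cons_of_mem _ hy) z (List.mem_cons_of_mem _ hz))]
    · rw [map_res (h := Function.update f x (h x)) (fun y hy => by simp [hy])]
      · simp
      · intro y hy hyx
        rw [fn_resList] at hy
        simp only [Function.update_self]
        intro he
        exact hx y hy.1 (by simpa [hyx] using hy.2) (by simp [he])
    · intro y hy
      by_cases hyx : y = x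
      · simp [hyx]
      · simp [hyx, hf y (by simp [hyx, hy])]
    · intro y hyP hy
      by_cases hyx : y = x
      · subst hyx
        simp only [Function.update_self, List.mem_map, not_exists, not_and]
        intro z hz he
        exact hy (hi z (List.mem_cons_of_mem _ hz) y (by simp) he ▸ hz)
      · simp only [Function.update_of_ne hyx]
        intro hm
        exact hx y hyP (by simp [hyx, hy]) (by simp at hm ⊢; tauto)

end Proc

/-! ### Transitions -/

/-- The rule for applications mentions a name for the parameter, but all admissible choices present
the same process; opening the body with `b` removes the choice. -/
theorem Trans.app_iff {P : Proc} {b : ℕ} {μ : Act} {S : Proc} :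
    Trans (.app P b) μ S ↔ Trans (P.map (unbindNames [b])) μ S := by
  constructor
  · intro h
    generalize hX : Proc.app P b = X at h
    cases h with
    | app x b' h =>
      simp only [Abs.mk', Abs.app, Proc.app.injEq] at hX
      obtain ⟨rfl, rfl⟩ := hX
      rw [Proc.map_map]
      convert h using 2
      funext y
      have := unbindNames_lift_bindNames_singleton id x b y
      rw [lift_id] at this
      simpa [substNames_singleton] using this
    | _ => simp [Proc.input, Proc.repInput, Proc.res] at hX
  · intro h
    obtain ⟨x, hx⟩ := exists_fresh P.fn_finite
    have hP : P = (P.map (unbindNames [x])).map (bindNames [x]) := by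
      refine (Proc.map_bindNames_map_unbindNames (List.nodup_singleton x) fun y hy hm => ?_).symm
      have := hx _ hm
      simp at hy this
      omega
    have := Trans.app (P := P.map (unbindNames [x])) (μ := μ) (P' := S) x b (by
      rw [Proc.map_map]
      convert h using 1
      refine Proc.map_congr fun i hi => ?_
      have hix := hx i hi
      rcases i with _ | i
      · simp [unbindNames, substNames_singleton]
      · simp only [Function.comp, substNames_singleton]
        rw [unbindNames_of_le (by simp), unbindNames_of_le (by simp), if_neg]
        simp; omega)
    rw [Abs.mk', Abs.app, ← hP] at this
    exact this

/-- In a communication, a free name of the receiver's derivative that is not an input parameter was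
already free in the receiver, and so is not an extruded name. -/
theorem Trans.fn_subset_of_inp {P P' : Proc} {μ : Act} (h : Trans P μ P') :
    ∀ {a : ℕ} {cs : List ℕ}, μ = .inp a cs → P'.fn ⊆ P.fn ∪ {y | y ∈ cs} := by
  induction h with
  | inp a bs P hb =>
    rintro _ _ ⟨⟩ y hy
    rw [Proc.fn_input]
    simp only [Set.mem_union, Set.mem_sdiff, Set.mem_ofPred_eq]; tauto
  | rep a bs P hb ha =>
    rintro _ _ ⟨⟩ y hy
    simp only [Proc.fn, Proc.fn_repInput, Set.mem_union, Set.mem_sdiff, Set.mem_ofPred_eq] at hy ⊢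
    tauto
  | parL Q h hd ih =>
    rintro a cs rfl y hy
    have := @ih a cs rfl y
    simp only [Proc.fn, Set.mem_union] at hy this ⊢
    tauto
  | parR Q h hd ih =>
    rintro a cs rfl y hy
    have := @ih a cs rfl y
    simp only [Proc.fn, Set.mem_union] at hy this ⊢
    tauto
  | res x h hx ih =>
    rintro a cs rfl y hy
    have := @ih a cs rfl y
    simp only [Proc.fn_res, Set.mem_union, Set.mem_sdiff] at hy this ⊢
    tauto
  | app x b h ih =>
    rintro a cs rfl y hy
    have := @ih a cs rfl y hy
    rw [Proc.fn_mk'_app]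
    rw [Proc.fn_map] at this
    rcases this with ⟨z, hz, rfl⟩ | h'
    · rw [substNames_singleton]
      split_ifs with hzx
      · simp
      · left; left; exact ⟨hz, hzx⟩
    · exact Or.inr h'
  | _ => rintro _ _ ⟨⟩

/-- After a renaming, the side condition of scope extrusion requires the subject to differ from the
new extruded name. Freshness of that name gives this once the subject is known to be free. -/
theorem Trans.subject_mem_fn_of_out {P P' : Proc} {μ : Act} (h : Trans P μ P') :
    ∀ {ds : Finset ℕ} {a : ℕ} {bs : List ℕ}, μ = .out ds a bs → a ∈ P.fn := by
  induction h with
  | out a bs => rintro _ _ _ ⟨⟩; simp [Proc.fn]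
  | parL Q h hd ih => rintro _ _ _ rfl; exact Or.inl (ih rfl)
  | parR Q h hd ih => rintro _ _ _ rfl; exact Or.inr (ih rfl)
  | res x h hx ih =>
    rintro _ _ _ rfl
    rw [Proc.fn_res]
    exact ⟨ih rfl, fun h => hx (by simp at h; simp [Act.names, h])⟩
  | opn c h h1 h2 h3 ih =>
    rintro _ _ _ ⟨⟩
    rw [Proc.fn_res]
    exact ⟨ih rfl, h3⟩
  | app x b h ih =>
    rintro _ _ _ rfl
    have := ih rfl
    rw [Proc.fn_mk'_app]
    rw [Proc.fn_map] at this
    obtain ⟨z, hz, rfl⟩ := this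
    rw [substNames_singleton]
    split_ifs with hzx
    · simp
    · left; exact ⟨hz, hzx⟩
  | _ => rintro _ _ _ ⟨⟩

theorem Act.bn_finite (μ : Act) : μ.bn.Finite := by
  cases μ with
  | tau => exact Set.finite_empty
  | inp a bs => exact List.finite_toSet bs
  | out ds a bs => exact ds.finite_toSet

theorem Act.names_finite (μ : Act) : μ.names.Finite := by
  cases μ with
  | tau => exact Set.finite_empty
  | inp a bs => exact (Set.finite_singleton a).union (List.finite_toSet bs)
  | out ds a bs => exact (ds.finite_toSet.union (Set.finite_singleton a)).union (List.finite_toSet bs)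

theorem Act.bn_subset_names (μ : Act) : μ.bn ⊆ μ.names := by
  cases μ with
  | tau => exact Set.Subset.rfl
  | inp a bs => exact Set.subset_union_right
  | out ds a bs => exact Set.subset_union_left.trans Set.subset_union_left

/-- The renaming of an action, by `f` on the subject and by `h` on the object names. -/
def Act.ren (f h : ℕ → ℕ) : Act → Act
  | tau => tau
  | inp a bs => inp (f a) (bs.map h)
  | out ds a bs => out (ds.image h) (f a) (bs.map h)

theorem Act.ren_id (μ : Act) : μ.ren id id = μ := by
  cases μ <;> simp [ren]

theorem Act.ren_congr {μ : Act} {f f' h h' : ℕ → ℕ} (hf : ∀ y ∈ μ.names, f y = f' y)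
    (hh : ∀ y ∈ μ.names, h y = h' y) : μ.ren f h = μ.ren f' h' := by
  cases μ with
  | tau => rfl
  | inp a bs =>
    simp only [ren]
    rw [hf a (by simp [names]), List.map_congr_left fun y hy => hh y (by simp [names, hy])]
  | out ds a bs =>
    simp only [ren]
    rw [hf a (by simp [names]), List.map_congr_left fun y hy => hh y (by simp [names, hy]),
      Finset.image_congr fun y hy => hh y (by simp [names, Finset.mem_coe.mp hy])]

theorem Act.bn_ren (μ : Act) (f h : ℕ → ℕ) : (μ.ren f h).bn = h '' μ.bn := by
  cases μ with
  | tau => simp [ren, bn]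
  | inp a bs => simp only [ren, bn, List.mem_map]; rfl
  | out ds a bs => simp [ren, bn]

/-! ### Contextual closures -/

/-- The contextual closure of `W`: the pairs `C[P̃]`, `C[Q̃]` for `W`-related `P̃`, `Q̃`. -/
inductive CtxClosure (W : Proc → Proc → Prop) : Proc → Proc → Prop
  | refl (P : Proc) : CtxClosure W P P
  | hole {P Q : Proc} : W P Q → CtxClosure W P Q
  | inp (a k : ℕ) {P Q : Proc} : CtxClosure W P Q → CtxClosure W (.inp a k P) (.inp a k Q)
  | par {P P' Q Q' : Proc} : CtxClosure W P Q → CtxClosure W P' Q' →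
      CtxClosure W (.par P P') (.par Q Q')
  | nu {P Q : Proc} : CtxClosure W P Q → CtxClosure W (.nu P) (.nu Q)
  | rep (a k : ℕ) {P Q : Proc} : CtxClosure W P Q → CtxClosure W (.rep a k P) (.rep a k Q)
  | app {P Q : Proc} (b : ℕ) : CtxClosure W P Q → CtxClosure W (.app P b) (.app Q b)

/-- The closure of `W` under the contexts whose holes occur only underneath prefixes. -/
inductive GuardedClosure (W : Proc → Proc → Prop) : Proc → Proc → Prop
  | refl (P : Proc) : GuardedClosure W P P
  | inp (a k : ℕ) {P Q : Proc} : CtxClosure W P Q → GuardedClosure W (.inp a k P) (.inp a k Q)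
  | par {P P' Q Q' : Proc} : GuardedClosure W P Q → GuardedClosure W P' Q' →
      GuardedClosure W (.par P P') (.par Q Q')
  | nu {P Q : Proc} : GuardedClosure W P Q → GuardedClosure W (.nu P) (.nu Q)
  | rep (a k : ℕ) {P Q : Proc} : CtxClosure W P Q → GuardedClosure W (.rep a k P) (.rep a k Q)
  | app {P Q : Proc} (b : ℕ) : GuardedClosure W P Q → GuardedClosure W (.app P b) (.app Q b)

/-! ### Closure properties and transitions of contextual closures -/

variable {W : Proc → Proc → Prop}

/-- `W` is closed under name substitutions. -/
def MapClosed (W : Proc → Proc → Prop) : Prop := ∀ P Q, W P Q → ∀ f, W (P.map f) (Q.map f)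

theorem CtxClosure.map (hW : MapClosed W) {P Q : Proc} (h : CtxClosure W P Q) :
    ∀ f, CtxClosure W (P.map f) (Q.map f) := by
  induction h with
  | refl P => exact fun f => .refl _
  | hole h => exact fun f => .hole (hW _ _ h f)
  | inp a k _ ih => exact fun f => .inp _ _ (ih _)
  | par _ _ ih ih' => exact fun f => .par (ih _) (ih' _)
  | nu _ ih => exact fun f => .nu (ih _)
  | rep a k _ ih => exact fun f => .rep _ _ (ih _)
  | app b _ ih => exact fun f => .app _ (ih _)

theorem GuardedClosure.ctxClosure {P Q : Proc} (h : GuardedClosure W P Q) : CtxClosure W P Q := by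
  induction h with
  | refl P => exact .refl P
  | inp a k h => exact .inp a k h
  | par _ _ ih ih' => exact .par ih ih'
  | nu _ ih => exact .nu ih
  | rep a k h => exact .rep a k h
  | app b _ ih => exact .app b ih

theorem GuardedClosure.map (hW : MapClosed W) {P Q : Proc} (h : GuardedClosure W P Q) :
    ∀ f, GuardedClosure W (P.map f) (Q.map f) := by
  induction h with
  | refl P => exact fun f => .refl _
  | inp a k h => exact fun f => .inp _ _ (h.map hW _)
  | par _ _ ih ih' => exact fun f => .par (ih _) (ih' _)
  | nu _ ih => exact fun f => .nu (ih _)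
  | rep a k h => exact fun f => .rep _ _ (h.map hW _)
  | app b _ ih => exact fun f => .app _ (ih _)

theorem CtxClosure.symm (hW : ∀ P Q, W P Q → W Q P) {P Q : Proc} (h : CtxClosure W P Q) :
    CtxClosure W Q P := by
  induction h with
  | refl P => exact .refl P
  | hole h => exact .hole (hW _ _ h)
  | inp a k _ ih => exact .inp _ _ ih
  | par _ _ ih ih' => exact .par ih ih'
  | nu _ ih => exact .nu ih
  | rep a k _ ih => exact .rep _ _ ih
  | app b _ ih => exact .app _ ih

theorem GuardedClosure.symm (hW : ∀ P Q, W P Q → W Q P) {P Q : Proc} (h : GuardedClosure W P Q) :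
    GuardedClosure W Q P := by
  induction h with
  | refl P => exact .refl P
  | inp a k h => exact .inp _ _ (h.symm hW)
  | par _ _ ih ih' => exact .par ih ih'
  | nu _ ih => exact .nu ih
  | rep a k h => exact .rep _ _ (h.symm hW)
  | app b _ ih => exact .app _ ih

theorem CtxClosure.res (hW : MapClosed W) {P Q : Proc} (h : CtxClosure W P Q) (x : ℕ) :
    CtxClosure W (.res x P) (.res x Q) :=
  .nu (h.map hW _)

theorem CtxClosure.resList (hW : MapClosed W) {P Q : Proc} (h : CtxClosure W P Q) (xs : List ℕ) :
    CtxClosure W (.resList xs P) (.resList xs Q) := by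
  induction xs with
  | nil => exact h
  | cons x xs ih => exact ih.res hW x

theorem GuardedClosure.inp_inv {a k : ℕ} {P R : Proc} (h : GuardedClosure W (.inp a k P) R) :
    ∃ Q, R = .inp a k Q ∧ CtxClosure W P Q := by
  cases h with
  | refl => exact ⟨P, rfl, .refl P⟩
  | inp _ _ h => exact ⟨_, rfl, h⟩

theorem GuardedClosure.rep_inv {a k : ℕ} {P R : Proc} (h : GuardedClosure W (.rep a k P) R) :
    ∃ Q, R = .rep a k Q ∧ CtxClosure W P Q := by
  cases h with
  | refl => exact ⟨P, rfl, .refl P⟩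
  | rep _ _ h => exact ⟨_, rfl, h⟩

theorem GuardedClosure.out_inv {a : ℕ} {bs : List ℕ} {R : Proc}
    (h : GuardedClosure W (.out a bs) R) : R = .out a bs := by
  cases h with
  | refl => rfl

theorem GuardedClosure.par_inv {P Q R : Proc} (h : GuardedClosure W (.par P Q) R) :
    ∃ P' Q', R = .par P' Q' ∧ GuardedClosure W P P' ∧ GuardedClosure W Q Q' := by
  cases h with
  | refl => exact ⟨P, Q, rfl, .refl P, .refl Q⟩
  | par h h' => exact ⟨_, _, rfl, h, h'⟩

theorem GuardedClosure.nu_inv {P R : Proc} (h : GuardedClosure W (.nu P) R) :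
    ∃ Q, R = .nu Q ∧ GuardedClosure W P Q := by
  cases h with
  | refl => exact ⟨P, rfl, .refl P⟩
  | nu h => exact ⟨_, rfl, h⟩

theorem GuardedClosure.app_inv {P R : Proc} {b : ℕ} (h : GuardedClosure W (.app P b) R) :
    ∃ Q, R = .app Q b ∧ GuardedClosure W P Q := by
  cases h with
  | refl => exact ⟨P, rfl, .refl P⟩
  | app _ h => exact ⟨_, rfl, h⟩

/-- Every process related by guarded contexts to an instance of `P` matches the transition
`P —μ→ P'`, for every choice `h` of fresh bound names. -/
def Matched (W : Proc → Proc → Prop) (P : Proc) (μ : Act) (P' : Proc) : Prop :=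
  ∀ (f h : ℕ → ℕ) (Q : Proc), GuardedClosure W (P.map f) Q → (∀ y, y ∉ μ.bn → h y = f y) →
    (∀ x ∈ μ.bn, ∀ y ∈ μ.bn, h x = h y → x = y) → (∀ y ∈ μ.bn, h y ∉ Q.fn) →
    (∀ y ∈ μ.bn, ∀ z ∈ P.fn, f z ≠ h y) →
    ∃ Q', Trans Q (μ.ren f h) Q' ∧ CtxClosure W (P'.map h) Q'

/-- Firing the prefix brings the holes below it to the surface, so the derivatives are related by
arbitrary contexts only. -/
theorem Matched.input (hW : MapClosed W) {a : ℕ} {bs : List ℕ} {P : Proc} (hb : bs.Nodup) :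
    Matched W (.input a bs P) (.inp a bs) P := by
  intro f h Q hQ hf hi hfn _
  obtain ⟨Q₁, rfl, hC⟩ := hQ.inp_inv
  have hn : (bs.map h).Nodup := hb.map_on hi
  have hfr : ∀ y ∈ bs.map h, y + (bs.map h).length ∉ Q₁.fn := by
    intro y hy hm
    obtain ⟨z, hz, rfl⟩ := List.mem_map.mp hy
    exact hfn z hz (Or.inr (by simpa using hm))
  have hQe := Proc.inp_eq_input (f a) hn hfr
  rw [List.length_map] at hQe
  refine ⟨Q₁.map (unbindNames (bs.map h)), ?_, ?_⟩
  · rw [hQe]; exact Trans.inp _ _ _ hn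
  · have := hC.map hW (unbindNames (bs.map h))
    rw [Proc.map_map, Proc.map_map] at this
    convert this using 2
    funext y
    exact (unbindNames_lift_bindNames hf y).symm

theorem Matched.repInput (hW : MapClosed W) {a : ℕ} {bs : List ℕ} {P : Proc} (hb : bs.Nodup)
    (ha : a ∉ bs) :
    Matched W (.repInput a bs P) (.inp a bs) (.par P (.repInput a bs P)) := by
  intro f h Q hQ hf hi hfn hfn'
  have hQc := hQ.ctxClosure
  obtain ⟨Q₁, rfl, hC⟩ := hQ.rep_inv
  have hn : (bs.map h).Nodup := hb.map_on hi
  have hfr : ∀ y ∈ bs.map h, y + (bs.map h).length ∉ Q₁.fn := by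
    intro y hy hm
    obtain ⟨z, hz, rfl⟩ := List.mem_map.mp hy
    exact hfn z hz (Or.inr (by simpa using hm))
  have hQe := Proc.rep_eq_repInput (f a) hn hfr
  rw [List.length_map] at hQe
  -- The copy that stays behind has none of `bs` free, because `a` is not in `bs`; the choice of
  -- bound names does not affect it.
  have hself : (Proc.repInput a bs P).map h = (Proc.repInput a bs P).map f := by
    refine Proc.map_congr fun y hy => hf y fun hyb => ?_
    rw [Proc.fn_repInput] at hy
    rcases hy with rfl | hy
    · exact ha hyb
    · exact hy.2 hyb
  refine ⟨.par (Q₁.map (unbindNames (bs.map h))) (.rep (f a) bs.length Q₁), ?_, ?_⟩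
  · rw [hQe]
    refine Trans.rep _ _ _ hn fun hm => ?_
    obtain ⟨z, hz, he⟩ := List.mem_map.mp hm
    exact hfn' z hz a (by simp [Proc.fn_repInput]) he.symm
  · refine .par ?_ ?_
    · have := hC.map hW (unbindNames (bs.map h))
      rw [Proc.map_map, Proc.map_map] at this
      convert this using 2
      funext y
      exact (unbindNames_lift_bindNames hf y).symm
    · rw [hself]; exact hQc

theorem Matched.parL {P P' Q : Proc} {μ : Act} (h : Matched W P μ P') (hd : Disjoint μ.bn Q.fn) :
    Matched W (.par P Q) μ (.par P' Q) := by
  intro f g R hR hf hi hfn hfn'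
  obtain ⟨R₁, R₂, rfl, h₁, h₂⟩ := hR.par_inv
  obtain ⟨R', ht, hc⟩ := h f g R₁ h₁ hf hi (fun y hy hm => hfn y hy (Or.inl hm))
    (fun y hy z hz => hfn' y hy z (Or.inl hz))
  refine ⟨_, .parL R₂ ht ?_, .par hc ?_⟩
  · rw [Act.bn_ren, Set.disjoint_left]
    rintro _ ⟨y, hy, rfl⟩ hm
    exact hfn y hy (Or.inr hm)
  · rw [Proc.map_congr (g := f) fun y hy => hf y fun hb => Set.disjoint_left.mp hd hb hy]
    exact h₂.ctxClosure

theorem Matched.parR {P Q Q' : Proc} {μ : Act} (h : Matched W Q μ Q') (hd : Disjoint μ.bn P.fn) :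
    Matched W (.par P Q) μ (.par P Q') := by
  intro f g R hR hf hi hfn hfn'
  obtain ⟨R₁, R₂, rfl, h₁, h₂⟩ := hR.par_inv
  obtain ⟨R', ht, hc⟩ := h f g R₂ h₂ hf hi (fun y hy hm => hfn y hy (Or.inr hm))
    (fun y hy z hz => hfn' y hy z (Or.inr hz))
  refine ⟨_, .parR R₁ ht ?_, .par ?_ hc⟩
  · rw [Act.bn_ren, Set.disjoint_left]
    rintro _ ⟨y, hy, rfl⟩ hm
    exact hfn y hy (Or.inl hm)
  · rw [Proc.map_congr (g := f) fun y hy => hf y fun hb => Set.disjoint_left.mp hd hb hy]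
    exact h₁.ctxClosure

/-- The matching of the two premises of a communication. -/
theorem Matched.com (hW : MapClosed W) {P P' Q Q' : Proc} {a : ℕ} {bs cs ds : List ℕ}
    (hP : Trans P (.inp a cs) P') (hl : cs.length = bs.length)
    (hd : Disjoint {y | y ∈ ds} P.fn) (h₁ : Matched W P (.inp a cs) P')
    (h₂ : Matched W Q (.out ds.toFinset a bs) Q') {f : ℕ → ℕ} {R₁ R₂ : Proc}
    (hR₁ : GuardedClosure W (P.map f) R₁) (hR₂ : GuardedClosure W (Q.map f) R₂) :
    ∃ (g h : ℕ → ℕ) (R₁' R₂' : Proc),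
      Trans R₁ (.inp (f a) (cs.map g)) R₁' ∧
      Trans R₂ (.out (ds.map h).toFinset (f a) (bs.map h)) R₂' ∧
      (∀ x ∈ ds, ∀ y ∈ ds, h x = h y → x = y) ∧ (∀ y, y ∉ ds → h y = f y) ∧
      Disjoint {y | y ∈ ds.map h} R₁.fn ∧
      (∀ y ∈ (P'.map (substNames cs bs)).fn ∪ Q'.fn, y ∉ ds → f y ∉ ds.map h) ∧
      CtxClosure W ((P'.map (substNames cs bs)).map h)
        (R₁'.map (substNames (cs.map g) (bs.map h))) ∧
      CtxClosure W (Q'.map h) R₂' := by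
  obtain ⟨N, hN⟩ := exists_fresh (S := R₁.fn ∪ R₂.fn ∪ f '' (P.fn ∪ Q.fn ∪ P'.fn ∪
      ((P'.map (substNames cs bs)).fn ∪ Q'.fn)))
    (by
      refine (R₁.fn_finite.union R₂.fn_finite).union (Set.Finite.image _ ?_)
      exact (((P.fn_finite.union Q.fn_finite).union P'.fn_finite).union
        ((Proc.fn_finite _).union Q'.fn_finite)))
  have hNR₁ : ∀ y ∈ R₁.fn, y < N := fun y hy => hN y (Or.inl (Or.inl hy))
  have hNR₂ : ∀ y ∈ R₂.fn, y < N := fun y hy => hN y (Or.inl (Or.inr hy))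
  have hNf : ∀ y ∈ P.fn ∪ Q.fn ∪ P'.fn ∪ ((P'.map (substNames cs bs)).fn ∪ Q'.fn), f y < N :=
    fun y hy => hN _ (Or.inr ⟨y, hy, rfl⟩)
  -- Shifting by `N` sends bound names injectively above all free names in play. Input parameters
  -- and extruded names are renamed separately, since a name may have both roles.
  let ext : List ℕ → ℕ → ℕ := fun xs y => if y ∈ xs then y + N else f y
  have ext_mem : ∀ {xs y}, y ∈ xs → ext xs y = y + N := fun h => if_pos h
  have ext_not : ∀ {xs y}, y ∉ xs → ext xs y = f y := fun h => if_neg h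
  have ext_inj : ∀ xs, ∀ x ∈ xs, ∀ y ∈ xs, ext xs x = ext xs y → x = y := by
    intro xs x hx y hy he
    rw [ext_mem hx, ext_mem hy] at he
    omega
  have ext_ge : ∀ {xs : List ℕ} {z : ℕ}, z ∈ xs.map (ext xs) → N ≤ z := by
    intro xs z hz
    obtain ⟨y, hy, rfl⟩ := List.mem_map.mp hz
    rw [ext_mem hy]; omega
  obtain ⟨R₁', ht₁, hc₁⟩ := h₁ f (ext cs) R₁ hR₁ (fun y hy => ext_not hy) (ext_inj cs)
    (fun y hy hm => by have := hNR₁ _ hm; rw [ext_mem hy] at this; omega)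
    (fun y hy z hz he => by
      have := hNf z (by simp [hz]); rw [he, ext_mem hy] at this; omega)
  obtain ⟨R₂', ht₂, hc₂⟩ := h₂ f (ext ds) R₂ hR₂
    (fun y hy => ext_not (by simpa [Act.bn] using hy))
    (fun x hx y hy => ext_inj ds x (by simpa [Act.bn] using hx) y (by simpa [Act.bn] using hy))
    (fun y hy hm => by
      have := hNR₂ _ hm; rw [ext_mem (by simpa [Act.bn] using hy)] at this; omega)
    (fun y hy z hz he => by
      have := hNf z (by simp [hz])
      rw [he, ext_mem (by simpa [Act.bn] using hy)] at this; omega)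
  refine ⟨ext cs, ext ds, R₁', R₂', ht₁, ?_, ext_inj ds, fun y hy => ext_not hy, ?_, ?_, ?_, hc₂⟩
  · convert ht₂ using 1
    simp only [Act.ren, Act.out.injEq, and_true]
    ext y; simp
  · rw [Set.disjoint_left]
    intro z hz hm
    have := hNR₁ _ hm
    have := ext_ge hz
    omega
  · intro y hy _ hm
    have := hNf y (Or.inr hy)
    have := ext_ge hm
    omega
  · have := hc₁.map hW (substNames (cs.map (ext cs)) (bs.map (ext ds)))
    rw [Proc.map_map] at this ⊢
    convert this using 1
    refine Proc.map_congr fun y hy => ?_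
    -- A received name is replaced by the renamed object of the output; any other name was free in
    -- the receiver, so neither renaming of bound names touches it.
    by_cases hyc : y ∈ cs
    · exact (substNames_map hl hyc fun x hx => ext_inj cs y hyc x hx).symm
    · have hyP : y ∈ P.fn := (hP.fn_subset_of_inp rfl hy).resolve_right hyc
      simp only [Function.comp]
      rw [substNames_of_notMem hyc, ext_not hyc, substNames_of_notMem,
        ext_not fun hyd => Set.disjoint_left.mp hd hyd hyP]
      intro hm
      have := ext_ge hm
      have := hNf y (by simp [hyP])
      omega

/-- Guarded contexts act independently of the agents that fill them. -/
theorem Trans.matched (hW : MapClosed W) {P P' : Proc} {μ : Act} (ht : Trans P μ P') :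
    Matched W P μ P' := by
  induction ht with
  | inp a bs P hb => exact Matched.input hW hb
  | rep a bs P hb ha => exact Matched.repInput hW hb ha
  | out a bs =>
    intro f h Q hQ hf _ _ _
    obtain rfl := hQ.out_inv
    rw [show h = f from funext fun y => hf y (by simp [Act.bn])]
    exact ⟨.nil, by simpa [Act.ren] using Trans.out (f a) (bs.map f), .refl _⟩
  | parL Q _ hd ih => exact ih.parL hd
  | parR P _ hd ih => exact ih.parR hd
  | comL hP hQ hn hl hd ihP ihQ =>
    intro f h R hR hf _ _ _
    obtain rfl : h = f := funext fun y => hf y (by simp [Act.bn])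
    obtain ⟨R₁, R₂, rfl, hR₁, hR₂⟩ := hR.par_inv
    obtain ⟨g, k, R₁', R₂', ht₁, ht₂, hi, hk, hdis, hfr, hc₁, hc₂⟩ :=
      Matched.com hW hP hl hd ihP ihQ hR₁ hR₂
    refine ⟨_, .comL ht₁ ht₂ (hn.map_on hi) (by simpa using hl) hdis, ?_⟩
    rw [Proc.map_resList hn hi hk (by exact hfr)]
    exact (CtxClosure.par hc₁ hc₂).resList hW _
  | comR hQ hP hn hl hd ihQ ihP =>
    intro f h R hR hf _ _ _
    obtain rfl : h = f := funext fun y => hf y (by simp [Act.bn])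
    obtain ⟨R₁, R₂, rfl, hR₁, hR₂⟩ := hR.par_inv
    obtain ⟨g, k, R₁', R₂', ht₁, ht₂, hi, hk, hdis, hfr, hc₁, hc₂⟩ :=
      Matched.com hW hP hl hd ihP ihQ hR₂ hR₁
    refine ⟨_, .comR ht₂ ht₁ (hn.map_on hi) (by simpa using hl) hdis, ?_⟩
    rw [Proc.map_resList hn hi hk (by exact fun y hy => hfr y (Or.symm hy))]
    exact (CtxClosure.par hc₂ hc₁).resList hW _
  | @res P P' μ x ht hx ih =>
    intro f h R hR hf hi hfn hfn'
    obtain ⟨Q, rfl, hQ⟩ := hR.nu_inv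
    -- The matching process does not remember the name `x`, which may clash after the renaming. Its
    -- restriction is opened with a name fresh for it, for the renamed derivative and for the
    -- renamed action.
    obtain ⟨x', hx'⟩ := exists_fresh (S := (Proc.nu Q).fn ∪ h '' P'.fn ∪ (μ.ren f h).names)
      (((Proc.fn_finite _).union ((Proc.fn_finite _).image _)).union (Act.names_finite _))
    have hxQ : x' ∉ (Proc.nu Q).fn := fun hm => lt_irrefl _ (hx' _ (Or.inl (Or.inl hm)))
    have hxP : ∀ y ∈ P'.fn, h y ≠ x' := fun y hy he =>
      lt_irrefl _ (hx' x' (Or.inl (Or.inr ⟨y, hy, he⟩)))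
    have hxn : x' ∉ (μ.ren f h).names := fun hm => lt_irrefl _ (hx' _ (Or.inr hm))
    have hxb : ∀ y ∈ μ.bn, h y ≠ x' := by
      rintro y hy rfl
      refine hxn (Act.bn_subset_names _ ?_)
      rw [Act.bn_ren]; exact ⟨y, hy, rfl⟩
    have hbx : ∀ y ∈ μ.bn, y ≠ x := by
      rintro y hy rfl; exact hx (Act.bn_subset_names _ hy)
    have hnx : ∀ y ∈ μ.names, y ≠ x := by rintro y hy rfl; exact hx hy
    have hG : GuardedClosure W (P.map (Function.update f x x')) (Q.map (unbindNames [x'])) := by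
      have := hQ.map hW (unbindNames [x'])
      rw [Proc.map_map, Proc.map_map] at this
      convert this using 2
      funext y
      simp only [Function.comp]
      rw [unbindNames_lift_bindNames_singleton, Function.update_apply]
    have hh : ∀ y ∈ μ.bn, Function.update h x x' y = h y := fun y hy =>
      Function.update_of_ne (hbx y hy) _ _
    obtain ⟨Q', hT, hC⟩ := ih (Function.update f x x') (Function.update h x x')
      (Q.map (unbindNames [x'])) hG
      (fun y hy => by
        by_cases hyx : y = x
        · simp [hyx]
        · simp [hyx, hf y hy])
      (fun y hy z hz he => hi y hy z hz (by rwa [hh y hy, hh z hz] at he))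
      (fun y hy hm => by
        rw [hh y hy] at hm
        rcases Proc.fn_map_unbindNames _ _ hm with hm | hm
        · exact hxb y hy (by simpa using hm)
        · exact hfn y hy hm)
      (fun y hy z hz => by
        rw [hh y hy]
        by_cases hzx : z = x
        · subst hzx; rw [Function.update_self]; exact (hxb y hy).symm
        · rw [Function.update_of_ne hzx]
          exact hfn' y hy z (by rw [Proc.fn_res]; exact ⟨hz, hzx⟩))
    rw [Act.ren_congr (f' := f) (h' := h) (fun y hy => Function.update_of_ne (hnx y hy) _ _)
      (fun y hy => Function.update_of_ne (hnx y hy) _ _)] at hT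
    refine ⟨.res x' Q', ?_, ?_⟩
    · rw [Proc.nu_eq_res hxQ]; exact .res x' hT hxn
    · rw [Proc.map_res (h := Function.update h x x') (fun y hy => Function.update_of_ne hy _ _)
        (fun y hy _ => by rw [Function.update_self]; exact hxP y hy), Function.update_self]
      exact hC.res hW _
  | @opn P P' ds a bs c ht hcb hcd hac ih =>
    intro f h R hR hf hi hfn hfn'
    obtain ⟨Q, rfl, hQ⟩ := hR.nu_inv
    have hbn : ∀ y, y ∈ (Act.out (insert c ds) a bs).bn ↔ y = c ∨ y ∈ ds := by simp [Act.bn]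
    have hbn' : ∀ y, y ∈ (Act.out ds a bs).bn ↔ y ∈ ds := by simp [Act.bn]
    simp only [hbn] at hf hi hfn hfn'
    -- Here the restricted name becomes visible in the action, so it is opened with the prescribed
    -- name `h c` instead of an arbitrary fresh one.
    have hG : GuardedClosure W (P.map (Function.update f c (h c))) (Q.map (unbindNames [h c])) := by
      have := hQ.map hW (unbindNames [h c])
      rw [Proc.map_map, Proc.map_map] at this
      convert this using 2
      funext y
      simp only [Function.comp]
      rw [unbindNames_lift_bindNames_singleton, Function.update_apply]
    have hne : ∀ y ∈ ds, h y ≠ h c := fun y hy he =>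
      hcd (hi y (Or.inr hy) c (Or.inl rfl) he ▸ hy)
    obtain ⟨Q', hT, hC⟩ := ih (Function.update f c (h c)) h (Q.map (unbindNames [h c])) hG
      (fun y hy => by
        rw [hbn'] at hy
        by_cases hyc : y = c
        · simp [hyc]
        · rw [Function.update_of_ne hyc]; exact hf y (by tauto))
      (fun y hy z hz => hi y (Or.inr ((hbn' y).mp hy)) z (Or.inr ((hbn' z).mp hz)))
      (fun y hy hm => by
        rw [hbn'] at hy
        rcases Proc.fn_map_unbindNames _ _ hm with hm | hm
        · exact hne y hy (by simpa using hm)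
        · exact hfn y (Or.inr hy) hm)
      (fun y hy z hz => by
        rw [hbn'] at hy
        by_cases hzc : z = c
        · subst hzc; rw [Function.update_self]; exact (hne y hy).symm
        · rw [Function.update_of_ne hzc]
          exact hfn' y (Or.inr hy) z (by rw [Proc.fn_res]; exact ⟨hz, hzc⟩))
    refine ⟨Q', ?_, hC⟩
    rw [Proc.nu_eq_res (hfn c (Or.inl rfl))]
    simp only [Act.ren, Function.update_of_ne hac] at hT ⊢
    rw [Finset.image_insert]
    refine .opn (h c) hT (List.mem_map_of_mem hcb) ?_ ?_
    · intro hm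
      obtain ⟨y, hy, he⟩ := Finset.mem_image.mp hm
      exact hne y hy he
    · refine hfn' c (Or.inl rfl) a ?_
      rw [Proc.fn_res]
      exact ⟨ht.subject_mem_fn_of_out rfl, hac⟩
  | @app P P' μ x b ht ih =>
    intro f h R hR hf hi hfn hfn'
    obtain ⟨Q, rfl, hQ⟩ := hR.app_inv
    have hG : GuardedClosure W ((P.map (substNames [x] [b])).map f)
        (Q.map (unbindNames [f b])) := by
      have := hQ.map hW (unbindNames [f b])
      rw [Abs.mk', Proc.map_map, Proc.map_map] at this
      rw [Proc.map_map]
      convert this using 2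
      funext y
      simp only [Function.comp]
      rw [unbindNames_lift_bindNames_singleton, substNames_singleton]
      split_ifs <;> rfl
    obtain ⟨Q', hT, hC⟩ := ih f h _ hG hf hi
      (fun y hy hm => by
        rcases Proc.fn_map_unbindNames _ _ hm with hm | hm
        · exact hfn y hy (Or.inr (by simpa using hm))
        · exact hfn y hy (Or.inl hm))
      (fun y hy z hz => by
        refine hfn' y hy z ?_
        rw [Proc.fn_map] at hz
        obtain ⟨w, hw, rfl⟩ := hz
        rw [Proc.fn_mk'_app, substNames_singleton]
        split_ifs with hwx
        · exact Or.inr rfl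
        · exact Or.inl ⟨hw, hwx⟩)
    exact ⟨Q', Trans.app_iff.mpr hT, hC⟩

theorem GuardedClosure.exists_trans (hW : MapClosed W) {P Q P' : Proc} {μ : Act}
    (h : GuardedClosure W P Q) (ht : Trans P μ P') (hP : Disjoint μ.bn P.fn)
    (hQ : Disjoint μ.bn Q.fn) : ∃ Q', Trans Q μ Q' ∧ CtxClosure W P' Q' := by
  obtain ⟨Q', hT, hC⟩ := ht.matched hW id id Q (by rwa [Proc.map_id]) (fun _ _ => rfl)
    (fun _ _ _ _ => id) (fun y hy => Set.disjoint_left.mp hQ hy)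
    (fun y hy z hz he => Set.disjoint_left.mp hP hy ((show z = y from he) ▸ hz))
  rw [Act.ren_id] at hT
  rw [Proc.map_id] at hC
  exact ⟨Q', hT, hC⟩

/-! ### Contexts for contextual closures -/

/-- Renumbering of the process holes. -/
def PCtx.reindex {m m' n : ℕ} (g : Fin m → Fin m') : PCtx m n → PCtx m' n
  | const P => const P
  | hole i => hole (g i)
  | holeApp j b => holeApp j b
  | input a bs C => input a bs (reindex g C)
  | par C D => par (reindex g C) (reindex g D)
  | res x C => res x (reindex g C)
  | repInput a bs C => repInput a bs (reindex g C)
  | absApp x C b => absApp x (reindex g C) b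

theorem PCtx.fill_reindex {m m' n : ℕ} (g : Fin m → Fin m') (Ps : Fin m' → Proc)
    (Fs : Fin n → Abs) (C : PCtx m n) : (C.reindex g).fill Ps Fs = C.fill (Ps ∘ g) Fs := by
  induction C <;> simp_all [reindex, fill]

theorem exists_fresh_list {S : Set ℕ} (h : S.Finite) (k : ℕ) :
    ∃ bs : List ℕ, bs.length = k ∧ bs.Nodup ∧ ∀ y ∈ bs, y ∉ S := by
  obtain ⟨N, hN⟩ := exists_fresh h
  refine ⟨(List.range k).map (· + N), by simp, ?_, ?_⟩
  · exact List.nodup_range.map fun a b hab => by simpa using hab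
  · intro y hy hS
    obtain ⟨z, _, rfl⟩ := List.mem_map.mp hy
    have := hN _ hS
    omega

/-- Closures are built with indices, contexts with capturing names. Crossing a binder turns its
indices into fresh names, so the induction has to carry a renaming, which `W` absorbs at the holes.
-/
theorem CtxClosure.exists_ctx_map (hW : MapClosed W) {P Q : Proc} (h : CtxClosure W P Q) :
    ∀ f : ℕ → ℕ, ∃ (n : ℕ) (Ps Qs : Fin n → Proc) (C : PCtx n 0),
      P.map f = C.fill Ps Fin.elim0 ∧ Q.map f = C.fill Qs Fin.elim0 ∧ ∀ i, W (Ps i) (Qs i) := by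
  have key : ∀ (P : Proc) (f : ℕ → ℕ) (bs : List ℕ), bs.Nodup →
      (∀ y ∈ bs, y + bs.length ∉ (P.map (lift bs.length f)).fn) →
      P.map (lift bs.length f) =
        (P.map (unbindNames bs ∘ lift bs.length f)).map (bindNames bs) := by
    intro P f bs hb hfr
    rw [← Proc.map_map, Proc.map_bindNames_map_unbindNames hb hfr]
  have fresh : ∀ (P Q : Proc) (f : ℕ → ℕ) (k : ℕ), ∃ bs : List ℕ, bs.length = k ∧ bs.Nodup ∧
      (∀ y ∈ bs, y + bs.length ∉ (P.map (lift bs.length f)).fn) ∧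
      (∀ y ∈ bs, y + bs.length ∉ (Q.map (lift bs.length f)).fn) := by
    intro P Q f k
    have hinj : Function.Injective (· + k : ℕ → ℕ) := fun a b hab => by simpa using hab
    obtain ⟨bs, rfl, hn, hb⟩ := exists_fresh_list
      (((P.map (lift k f)).fn_finite.union (Q.map (lift k f)).fn_finite).preimage
        (hinj.injOn (s := (· + k) ⁻¹' _))) k
    exact ⟨bs, rfl, hn, fun y hy hm => hb y hy (Or.inl hm), fun y hy hm => hb y hy (Or.inr hm)⟩
  induction h with
  | refl P => exact fun f => ⟨0, Fin.elim0, Fin.elim0, .const (P.map f), rfl, rfl, fun i => i.elim0⟩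
  | @hole P Q h =>
    exact fun f => ⟨1, fun _ => P.map f, fun _ => Q.map f, .hole 0, rfl, rfl, fun _ => hW _ _ h f⟩
  | @inp a k P Q _ ih =>
    intro f
    obtain ⟨bs, rfl, hn, hP, hQ⟩ := fresh P Q f k
    obtain ⟨n, Ps, Qs, C, h₁, h₂, h₃⟩ := ih (unbindNames bs ∘ lift bs.length f)
    refine ⟨n, Ps, Qs, .input (f a) bs C, ?_, ?_, h₃⟩
    · rw [Proc.map, key P f bs hn hP, h₁]; rfl
    · rw [Proc.map, key Q f bs hn hQ, h₂]; rfl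
  | par _ _ ih ih' =>
    intro f
    obtain ⟨n, Ps, Qs, C, h₁, h₂, h₃⟩ := ih f
    obtain ⟨n', Ps', Qs', C', h₁', h₂', h₃'⟩ := ih' f
    -- The holes of the two components get disjoint numbers.
    refine ⟨n + n', Fin.append Ps Ps', Fin.append Qs Qs',
      .par (C.reindex (Fin.castAdd n')) (C'.reindex (Fin.natAdd n)), ?_, ?_, ?_⟩
    · rw [Proc.map, h₁, h₁', PCtx.fill, PCtx.fill_reindex, PCtx.fill_reindex]
      congr <;> funext i <;> simp
    · rw [Proc.map, h₂, h₂', PCtx.fill, PCtx.fill_reindex, PCtx.fill_reindex]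
      congr <;> funext i <;> simp
    · intro i
      refine Fin.addCases (fun i => ?_) (fun i => ?_) i
      · simpa using h₃ i
      · simpa using h₃' i
  | @nu P Q _ ih =>
    intro f
    obtain ⟨bs, hl, hn, hP, hQ⟩ := fresh P Q f 1
    obtain ⟨x, rfl⟩ := List.length_eq_one_iff.mp hl
    obtain ⟨n, Ps, Qs, C, h₁, h₂, h₃⟩ := ih (unbindNames [x] ∘ lift 1 f)
    refine ⟨n, Ps, Qs, .res x C, ?_, ?_, h₃⟩
    · have := key P f [x] hn hP
      rw [List.length_singleton] at this
      rw [Proc.map, this, h₁]; rfl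
    · have := key Q f [x] hn hQ
      rw [List.length_singleton] at this
      rw [Proc.map, this, h₂]; rfl
  | @rep a k P Q _ ih =>
    intro f
    obtain ⟨bs, rfl, hn, hP, hQ⟩ := fresh P Q f k
    obtain ⟨n, Ps, Qs, C, h₁, h₂, h₃⟩ := ih (unbindNames bs ∘ lift bs.length f)
    refine ⟨n, Ps, Qs, .repInput (f a) bs C, ?_, ?_, h₃⟩
    · rw [Proc.map, key P f bs hn hP, h₁]; rfl
    · rw [Proc.map, key Q f bs hn hQ, h₂]; rfl
  | @app P Q b _ ih =>
    intro f
    obtain ⟨bs, hl, hn, hP, hQ⟩ := fresh P Q f 1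
    obtain ⟨x, rfl⟩ := List.length_eq_one_iff.mp hl
    obtain ⟨n, Ps, Qs, C, h₁, h₂, h₃⟩ := ih (unbindNames [x] ∘ lift 1 f)
    refine ⟨n, Ps, Qs, .absApp x C (f b), ?_, ?_, h₃⟩
    · have := key P f [x] hn hP
      rw [List.length_singleton] at this
      rw [Proc.map, this, h₁]; rfl
    · have := key Q f [x] hn hQ
      rw [List.length_singleton] at this
      rw [Proc.map, this, h₂]; rfl

theorem CtxClosure.exists_ctx (hW : MapClosed W) {P Q : Proc} (h : CtxClosure W P Q) :
    ∃ (n : ℕ) (Ps Qs : Fin n → Proc) (C : PCtx n 0),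
      P = C.fill Ps Fin.elim0 ∧ Q = C.fill Qs Fin.elim0 ∧ ∀ i, W (Ps i) (Qs i) := by
  simpa only [Proc.map_id] using h.exists_ctx_map hW id

/-! ### Processes with the same transitions -/

/-- The processes `P` and `Q`, and all their instances, have the same transitions. -/
def SameTrans (P Q : Proc) : Prop :=
  ∀ (f : ℕ → ℕ) (μ : Act) (S : Proc), Trans (P.map f) μ S ↔ Trans (Q.map f) μ S

theorem SameTrans.refl (P : Proc) : SameTrans P P := fun _ _ _ => Iff.rfl

theorem SameTrans.symm {P Q : Proc} (h : SameTrans P Q) : SameTrans Q P :=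
  fun f μ S => (h f μ S).symm

theorem SameTrans.trans {P Q R : Proc} (h : SameTrans P Q) (h' : SameTrans Q R) :
    SameTrans P R := fun f μ S => (h f μ S).trans (h' f μ S)

theorem SameTrans.map {P Q : Proc} (h : SameTrans P Q) (g : ℕ → ℕ) :
    SameTrans (P.map g) (Q.map g) := fun f μ S => by
  rw [Proc.map_map, Proc.map_map]; exact h _ μ S

theorem SameTrans.iff {P Q : Proc} (h : SameTrans P Q) {μ : Act} {S : Proc} :
    Trans P μ S ↔ Trans Q μ S := by
  have := h id μ S
  rwa [Proc.map_id, Proc.map_id] at this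

theorem SameTrans.app (P : Proc) (b : ℕ) : SameTrans (.app P b) (P.map (unbindNames [b])) := by
  intro f μ S
  rw [Proc.map, Trans.app_iff, Proc.map_map, Proc.map_map]
  have : unbindNames [f b] ∘ lift 1 f = f ∘ unbindNames [b] := by
    funext i
    rcases i with _ | i <;> simp [unbindNames, lift]
  rw [this]

theorem SameTrans.mk'_app (x : ℕ) (P : Proc) (b : ℕ) :
    SameTrans ((Abs.mk' x P).app b) (P.map (Function.update id x b)) := by
  have := SameTrans.app (P.map (bindNames [x])) b
  rw [Proc.map_map] at this
  have he : Function.update id x b = unbindNames [b] ∘ bindNames [x] := by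
    funext y
    have := unbindNames_lift_bindNames_singleton id x b y
    rw [lift_id] at this
    rw [Function.comp, Function.update_apply]
    exact this.symm
  rwa [he]

/-- A simultaneous substitution is a sequence of single ones if no target is a name still to be
replaced. An arbitrary renaming is split into two such substitutions: first to fresh names, then to
the targets. -/
theorem mapClosed_of_update {R : Proc → Proc → Prop}
    (h : ∀ P Q, R P Q → ∀ x b, R (P.map (Function.update id x b)) (Q.map (Function.update id x b))) :
    MapClosed R := by
  have step : ∀ (P Q : Proc), R P Q → ∀ (f : ℕ → ℕ) (l : List ℕ), (∀ y ∈ l, f y ∉ l) →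
      R (P.map fun y => if y ∈ l then f y else y) (Q.map fun y => if y ∈ l then f y else y) := by
    intro P Q hPQ f l
    induction l with
    | nil =>
      intro _
      rwa [Proc.map_eq_self fun y _ => by simp, Proc.map_eq_self fun y _ => by simp]
    | cons x l ih =>
      intro hl
      have hr := h _ _ (ih fun y hy hm => hl y (List.mem_cons_of_mem _ hy)
        (List.mem_cons_of_mem _ hm)) x (f x)
      rw [Proc.map_map, Proc.map_map] at hr
      convert hr using 2 <;>
      · funext y
        have hne : ∀ z ∈ x :: l, f z ≠ x := fun z hz he => hl z hz (he ▸ List.mem_cons_self)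
        simp only [Function.comp, Function.update_apply, id, List.mem_cons]
        by_cases hyl : y ∈ l
        · simp [hyl, hne y (List.mem_cons_of_mem _ hyl)]
        · by_cases hyx : y = x <;> simp [hyx, hyl]
          intro hx; exact absurd hx (hyx ▸ hyl)
  intro P Q hPQ f
  obtain ⟨n, hn⟩ := exists_fresh (P.fn_finite.union Q.fn_finite)
  -- All free names are below `n`, while `N` exceeds `n` and all their targets. So the block from
  -- `N` on avoids both the original names and the targets.
  obtain ⟨N, hN⟩ := exists_fresh (((Set.finite_Iio n).image f).union (Set.finite_Iic n))
  have hnN : n < N := hN n (Or.inr (Set.mem_Iic.mpr le_rfl))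
  have hfN : ∀ y, y < n → f y < N := fun y hy => hN _ (Or.inl ⟨y, hy, rfl⟩)
  have h₁ := step P Q hPQ (· + N) (List.range n) (by intro y _; simp; omega)
  have h₂ := step _ _ h₁ (fun z => f (z - N)) ((List.range n).map (· + N)) (by
    intro z hz hm
    simp only [List.mem_map, List.mem_range] at hz hm
    obtain ⟨y, hy, rfl⟩ := hz
    obtain ⟨w, hw, he⟩ := hm
    have := hfN y hy
    simp at he
    omega)
  rw [Proc.map_map, Proc.map_map] at h₂
  have key : ∀ y, y < n → ((fun z => if z ∈ (List.range n).map (· + N) then f (z - N) else z) ∘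
      fun y => if y ∈ List.range n then y + N else y) y = f y := by
    intro y hy
    simp [hy]
  rwa [Proc.map_congr fun y hy => key y (hn y (Or.inl hy)),
    Proc.map_congr fun y hy => key y (hn y (Or.inr hy))] at h₂

variable {eqv le : AgentRel}

namespace AgentRel

theorem IsPrecongruence.mk'_app {R : AgentRel} (hR : R.IsPrecongruence) {P Q : Proc}
    (h : R.proc P Q) (x b : ℕ) : R.proc ((Abs.mk' x P).app b) ((Abs.mk' x Q).app b) :=
  hR.pctx 1 0 (.absApp x (.hole 0) b) (fun _ => P) (fun _ => Q) Fin.elim0 Fin.elim0 (fun _ => h)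
    (fun j => j.elim0)

theorem IsPrecongruence.app {R : AgentRel} (hR : R.IsPrecongruence) {F G : Abs}
    (h : R.abs F G) (b : ℕ) : R.proc (F.app b) (G.app b) :=
  hR.pctx 0 1 (.holeApp 0 b) Fin.elim0 Fin.elim0 (fun _ => F) (fun _ => G) (fun j => j.elim0)
    (fun _ => h)

theorem IsPrecongruence.mk' {R : AgentRel} (hR : R.IsPrecongruence) {P Q : Proc}
    (h : R.proc P Q) (x : ℕ) : R.abs (Abs.mk' x P) (Abs.mk' x Q) :=
  hR.fctx 1 0 (.abs x (.hole 0)) (fun _ => P) (fun _ => Q) Fin.elim0 Fin.elim0 (fun _ => h)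
    (fun j => j.elim0)

theorem IsPrecongruence.fill {R : AgentRel} (hR : R.IsPrecongruence) {n : ℕ} (C : FCtx 0 n)
    {Fs Gs : Fin n → Abs} (h : ∀ j, R.abs (Fs j) (Gs j)) :
    R.abs (C.fill Fin.elim0 Fs) (C.fill Fin.elim0 Gs) :=
  hR.fctx 0 n C _ _ Fs Gs (fun j => j.elim0) h

end AgentRel

/-- A relation on processes that is closed under substitutions and under processes with the same
transitions relates the bodies of abstractions if it relates their applications. -/
theorem MapClosed.body_of_app {R : Proc → Proc → Prop} (hR : MapClosed R)
    (hs : ∀ P P' Q Q', SameTrans P P' → SameTrans Q Q' → R P Q → R P' Q') {F G : Abs}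
    (h : ∀ b, R (F.app b) (G.app b)) (f : ℕ → ℕ) : R (F.body.map f) (G.body.map f) := by
  -- A fresh argument marks the occurrences of the parameter; the renaming below sends it to `f 0`
  -- and undoes the shift of the other names.
  obtain ⟨N, hN⟩ := exists_fresh (F.body.fn_finite.union G.body.fn_finite)
  have := hR _ _ (hs _ _ _ _ (SameTrans.app _ _) (SameTrans.app _ _) (h N))
    (fun y => if y = N then f 0 else f (y + 1))
  rw [Proc.map_map, Proc.map_map] at this
  have key : ∀ y, y < N → ((fun y => if y = N then f 0 else f (y + 1)) ∘ unbindNames [N]) y = f y := by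
    intro y hy
    rcases y with _ | y
    · simp [unbindNames]
    · simp [unbindNames]; omega
  rwa [Proc.map_congr fun y hy => key y (hN y (Or.inl hy)),
    Proc.map_congr fun y hy => key y (hN y (Or.inr hy))] at this

/-! ### The congruence -/

/-- After one matching step the two processes coincide, so a context without holes suffices. -/
theorem SameTrans.eqv_proc (hle : le.IsPrecongruence) (hupto : ValidatesUpTo eqv le) {P Q : Proc}
    (h : SameTrans P Q) : eqv.proc P Q := by
  refine hupto SameTrans (fun _ _ => SameTrans.symm) ?_ P Q h
  intro P Q hPQ μ P' _ ht
  have ht' := hPQ.iff.mp ht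
  refine ⟨P', ?_, 0, Fin.elim0, Fin.elim0, .const P', hle.refl_proc _, hle.refl_proc _,
    fun i => i.elim0⟩
  by_cases hμ : μ = .tau
  · subst hμ; exact Or.inl ⟨rfl, .single ht'⟩
  · exact Or.inr ⟨hμ, Q, P', .refl, ht', .refl⟩

theorem AgentRel.IsCongruence.of_sameTrans (heqv : eqv.IsCongruence) (hle : le.IsPrecongruence)
    (hupto : ValidatesUpTo eqv le) {P P' Q Q' : Proc} (hP : SameTrans P P') (hQ : SameTrans Q Q')
    (h : eqv.proc P Q) : eqv.proc P' Q' :=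
  heqv.trans_proc _ _ _ (hP.symm.eqv_proc hle hupto) (heqv.trans_proc _ _ _ h (hQ.eqv_proc hle hupto))

/-- A single substitution is simulated by applying an abstraction, which is a context; the
simulation is exact up to `SameTrans`, hence up to the congruence. -/
theorem AgentRel.IsCongruence.mapClosed (heqv : eqv.IsCongruence) (hle : le.IsPrecongruence)
    (hupto : ValidatesUpTo eqv le) : MapClosed eqv.proc :=
  mapClosed_of_update fun _ _ h x b =>
    heqv.of_sameTrans hle hupto (SameTrans.mk'_app x _ b) (SameTrans.mk'_app x _ b)
      (heqv.toIsPrecongruence.mk'_app h x b)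

theorem AgentRel.IsCongruence.body (heqv : eqv.IsCongruence) (hle : le.IsPrecongruence)
    (hupto : ValidatesUpTo eqv le) {F G : Abs} (h : eqv.abs F G) (f : ℕ → ℕ) :
    eqv.proc (F.body.map f) (G.body.map f) :=
  (heqv.mapClosed hle hupto).body_of_app (fun _ _ _ _ => heqv.of_sameTrans hle hupto)
    (fun b => heqv.toIsPrecongruence.app h b) f

theorem AgentRel.IsCongruence.abs_of_body (heqv : eqv.IsCongruence) {F G : Abs}
    (h : ∀ f, eqv.proc (F.body.map f) (G.body.map f)) : eqv.abs F G := by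
  obtain ⟨N, hN⟩ := exists_fresh (F.body.fn_finite.union G.body.fn_finite)
  have := heqv.toIsPrecongruence.mk' (h (unbindNames [N])) N
  simp only [Abs.mk'] at this
  rwa [Proc.map_bindNames_map_unbindNames (List.nodup_singleton N),
    Proc.map_bindNames_map_unbindNames (List.nodup_singleton N)] at this
  · intro y hy hm
    have := hN _ (Or.inr hm)
    simp at hy this; omega
  · intro y hy hm
    have := hN _ (Or.inl hm)
    simp at hy this; omega

theorem AgentRel.IsCongruence.abs_map (heqv : eqv.IsCongruence) (hle : le.IsPrecongruence)
    (hupto : ValidatesUpTo eqv le) {F G : Abs} (h : eqv.abs F G) (f : ℕ → ℕ) :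
    eqv.abs (F.map f) (G.map f) :=
  heqv.abs_of_body fun g => by
    simp only [Abs.map, Proc.map_map]
    exact heqv.body hle hupto h _

/-! ### Expansion up to processes with the same transitions -/

/-- `P` expands `X`, up to processes with the same transitions. -/
def ExpandsTo (le : AgentRel) (P X : Proc) : Prop :=
  ∃ A B, SameTrans P A ∧ le.proc B A ∧ SameTrans B X

theorem ExpandsTo.mapClosed (hle : le.IsPrecongruence) : MapClosed (ExpandsTo le) :=
  mapClosed_of_update fun _ _ ⟨A, B, h₁, h₂, h₃⟩ x b =>
    ⟨(Abs.mk' x A).app b, (Abs.mk' x B).app b, (h₁.map _).trans (SameTrans.mk'_app x A b).symm,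
      hle.mk'_app h₂ x b, (SameTrans.mk'_app x B b).trans (h₃.map _)⟩

theorem ExpandsTo.of_abs (hle : le.IsPrecongruence) {F G : Abs} (h : le.abs G F) (f : ℕ → ℕ) :
    ExpandsTo le (F.body.map f) (G.body.map f) :=
  (ExpandsTo.mapClosed hle).body_of_app
    (fun _ _ _ _ h₁ h₂ ⟨A, B, h₃, h₄, h₅⟩ => ⟨A, B, h₁.symm.trans h₃, h₄, h₅.trans h₂⟩)
    (fun b => ⟨_, _, .refl _, hle.app h b, .refl _⟩) f

/-- The replacement of the names `l` by the name `c`. -/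
def collapse (l : List ℕ) (c y : ℕ) : ℕ := if y ∈ l then c else y

/-- Wrapping both sides in `((y) [·])⟨c⟩` for each `y` of `l` preserves the expansion and really
removes these names, as the freshness convention on actions demands. -/
theorem exists_le_collapse (hle : le.IsPrecongruence) {A B : Proc} (h : le.proc B A) {c : ℕ}
    (l : List ℕ) (hc : c ∉ l) : ∃ A' B', le.proc B' A' ∧ SameTrans A' (A.map (collapse l c)) ∧
      SameTrans B' (B.map (collapse l c)) ∧ ∀ y ∈ l, y ∉ A'.fn ∧ y ∉ B'.fn := by
  induction l with
  | nil =>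
    refine ⟨A, B, h, ?_, ?_, by simp⟩ <;>
    · rw [Proc.map_eq_self fun y _ => by simp [collapse]]; exact .refl _
  | cons x l ih =>
    simp only [List.mem_cons, not_or] at hc
    obtain ⟨A', B', h₁, h₂, h₃, h₄⟩ := ih hc.2
    have hcomp : collapse (x :: l) c = Function.update id x c ∘ collapse l c := by
      funext y
      simp only [collapse, Function.comp, Function.update_apply, id, List.mem_cons]
      by_cases hy : y ∈ l
      · simp [hy]
      · by_cases hx : y = x
        · subst hx; simp [hy]
        · simp [hy, hx]
    refine ⟨(Abs.mk' x A').app c, (Abs.mk' x B').app c, hle.mk'_app h₁ x c, ?_, ?_, ?_⟩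
    · rw [hcomp, ← Proc.map_map]; exact (SameTrans.mk'_app _ _ _).trans (h₂.map _)
    · rw [hcomp, ← Proc.map_map]; exact (SameTrans.mk'_app _ _ _).trans (h₃.map _)
    · intro y hy
      rw [Proc.fn_mk'_app, Proc.fn_mk'_app]
      have hyc : y ≠ c := by rintro rfl; simp at hy; tauto
      rcases List.mem_cons.mp hy with rfl | hy
      · simp [hyc]
      · simp [hyc, h₄ y hy]

/-- An expansion, with the names `l` avoided. -/
theorem ExpandsTo.exists_fresh_of (hle : le.IsPrecongruence) {P X : Proc} (h : ExpandsTo le P X)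
    {c : ℕ} {l : List ℕ} (hc : c ∉ l) (hP : ∀ y ∈ l, y ∉ P.fn) :
    ∃ A B, SameTrans P A ∧ le.proc B A ∧ SameTrans B (X.map (collapse l c)) ∧
      ∀ y ∈ l, y ∉ A.fn ∧ y ∉ B.fn := by
  obtain ⟨A, B, h₁, h₂, h₃⟩ := h
  obtain ⟨A', B', k₁, k₂, k₃, k₄⟩ := exists_le_collapse hle h₂ l hc
  refine ⟨A', B', ?_, k₁, k₃.trans (h₃.map _), k₄⟩
  -- The names of `l` are not free in `P`, so the collapse leaves it unchanged.
  have := h₁.map (collapse l c)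
  rw [Proc.map_eq_self fun y hy => by
    rw [collapse, if_neg fun hl => hP y hl hy]] at this
  exact this.trans k₂.symm

theorem notMem_fn_map_collapse {P : Proc} {c y : ℕ} {l : List ℕ} (hc : c ∉ l) (hy : y ∈ l) :
    y ∉ (P.map (collapse l c)).fn := by
  rw [Proc.fn_map]
  rintro ⟨z, _, rfl⟩
  simp only [collapse] at hy
  split_ifs at hy <;> contradiction

/-- A weak transition contains at least one step, and only the first one depends on the starting
process. -/
theorem SameTrans.weak {P Q S : Proc} {μ : Act} (h : SameTrans P Q) (hw : Weak Q μ S) :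
    Weak P μ S := by
  obtain ⟨S₁, S₂, h₁, h₂, h₃⟩ := hw
  rcases Relation.ReflTransGen.cases_head h₁ with rfl | ⟨Z, hZ, hr⟩
  · exact ⟨P, S₂, .refl, h.iff.mpr h₂, h₃⟩
  · exact ⟨S₁, S₂, .head (h.iff.mpr hZ) hr, h₂, h₃⟩

theorem Weak.weakHat {P S : Proc} {μ : Act} (h : Weak P μ S) : WeakHat P μ S := by
  by_cases hμ : μ = .tau
  · subst hμ
    obtain ⟨S₁, S₂, h₁, h₂, h₃⟩ := h
    exact Or.inl ⟨rfl, h₁.trans (.head h₂ h₃)⟩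
  · exact Or.inr ⟨hμ, h⟩

/-- The processes that expand processes related by guarded contexts. -/
def GuardedExpansion (le : AgentRel) (W : Proc → Proc → Prop) (P Q : Proc) : Prop :=
  ∃ X Y, GuardedClosure W X Y ∧ ExpandsTo le P X ∧ ExpandsTo le Q Y

theorem GuardedExpansion.isUpToCandidate (hle : le.IsPrecongruence) (hexp : IsExpansion le.proc)
    (hW : MapClosed W) (hd : ∀ P Q, W P Q → eqv.proc P Q ∨
      ∀ s, GuardedExpansion le W (P.map s) (Q.map s)) :
    IsUpToCandidate eqv le (GuardedExpansion le W) := by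
  rintro P Q ⟨X, Y, hXY, hPX, hQY⟩ μ P' hfr ht
  -- The bound names of the action are fresh for `P` and `Q`, but may be free in the processes of
  -- the two expansions. They are collapsed to a name `c` outside the list.
  obtain ⟨l, hl⟩ : ∃ l : List ℕ, ∀ y, y ∈ l ↔ y ∈ μ.bn :=
    ⟨μ.bn_finite.toFinset.toList, by simp⟩
  obtain ⟨c, hc⟩ := exists_fresh (List.finite_toSet l)
  have hcl : c ∉ l := fun h => lt_irrefl _ (hc c h)
  obtain ⟨A, B, h₁, h₂, h₃, h₄⟩ := hPX.exists_fresh_of hle hcl fun y hy hm =>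
    Set.disjoint_left.mp hfr ((hl y).mp hy) (Or.inl hm)
  obtain ⟨A', B', k₁, k₂, k₃, k₄⟩ := hQY.exists_fresh_of hle hcl fun y hy hm =>
    Set.disjoint_left.mp hfr ((hl y).mp hy) (Or.inr hm)
  have hG := hXY.map hW (collapse l c)
  have hBA : FreshFor μ B A := Set.disjoint_left.mpr fun y hy hm => by
    have := h₄ y ((hl y).mpr hy)
    rcases hm with hm | hm
    · exact this.2 hm
    · exact this.1 hm
  have hBA' : FreshFor μ B' A' := Set.disjoint_left.mpr fun y hy hm => by
    have := k₄ y ((hl y).mpr hy)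
    rcases hm with hm | hm
    · exact this.2 hm
    · exact this.1 hm
  obtain ⟨S, hS, hSP⟩ := (hexp B A h₂ μ hBA).2 P' (h₁.iff.mp ht)
  rcases hS with hS | ⟨rfl, rfl⟩
  -- The smaller process moves too: the guarded context makes the same move on the other side, and
  -- `Q` catches up by the first clause of expansion.
  · obtain ⟨S', hS', hSS⟩ := hG.exists_trans hW (h₃.iff.mp hS)
      (Set.disjoint_left.mpr fun y hy => notMem_fn_map_collapse hcl ((hl y).mpr hy))
      (Set.disjoint_left.mpr fun y hy => notMem_fn_map_collapse hcl ((hl y).mpr hy))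
    obtain ⟨Q', hQ', hSQ⟩ := (hexp B' A' k₂ μ hBA').1 S' (k₃.iff.mpr hS')
    obtain ⟨n, Ps, Qs, C, rfl, rfl, hC⟩ := hSS.exists_ctx hW
    refine ⟨Q', (k₁.weak hQ').weakHat, n, Ps, Qs, C, hSP, hSQ, fun i => ?_⟩
    refine (hd _ _ (hC i)).imp_right fun h => ⟨?_, fun _ => h⟩
    simpa only [Proc.map_id] using h id
  -- The τ step was absorbed by the expansion: `Q` stays put and the new pair is again in the
  -- candidate, in a bare hole, which is not under an input.
  · refine ⟨Q, Or.inl ⟨rfl, .refl⟩, 1, fun _ => P', fun _ => Q, .hole 0, hle.refl_proc _,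
      hle.refl_proc _, fun _ => Or.inr ⟨?_, fun h => h.elim⟩⟩
    exact ⟨_, _, hG, ⟨P', B, .refl _, hSP, h₃⟩, ⟨A', B', k₁, k₂, k₃⟩⟩

/-! ### The lambda-calculus -/

namespace Lam

theorem rename_rename (M : Lam) : ∀ f g : ℕ → ℕ, (M.rename g).rename f = M.rename (f ∘ g) := by
  induction M <;> intro f g <;> simp_all [rename, lift_comp]

theorem rename_id (M : Lam) : M.rename id = M := by
  induction M <;> simp_all [rename, lift_id]

theorem rename_congr {M : Lam} : ∀ {f g : ℕ → ℕ}, (∀ y ∈ M.fv, f y = g y) →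
    M.rename f = M.rename g := by
  induction M with
  | var x => intro f g h; simp only [rename]; rw [h x (by simp [fv])]
  | lam M ih =>
    intro f g h
    simp only [rename]
    rw [ih fun y hy => ?_]
    rcases y with _ | y
    · simp [lift]
    · rw [lift_add 1 f y, lift_add 1 g y, h y hy]
  | app M N ihM ihN =>
    intro f g h
    simp only [rename]
    rw [ihM fun y hy => h y (Or.inl hy), ihN fun y hy => h y (Or.inr hy)]

theorem fv_finite (M : Lam) : M.fv.Finite := by
  induction M with
  | var x => exact Set.finite_singleton x
  | lam M ih => exact ih.preimage (Function.Injective.injOn fun a b hab => by simpa using hab)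
  | app M N ihM ihN => exact ihM.union ihN

theorem lam_eq_abs {x : ℕ} {M : Lam} (h : x + 1 ∉ M.fv) :
    lam M = abs x (M.rename (unbindNames [x])) := by
  rw [abs, rename_rename, rename_congr (g := id), rename_id]
  intro i hi
  refine bindNames_unbindNames (List.nodup_singleton x) fun y hy he => ?_
  rw [List.mem_singleton] at hy
  subst hy
  exact h (he ▸ hi)

theorem rename_subst (M : Lam) : ∀ (σ : ℕ → Lam) (f : ℕ → ℕ),
    (M.subst σ).rename f = M.subst fun i => (σ i).rename f := by
  induction M with
  | var x => intros; rfl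
  | lam M ih =>
    intro σ f
    simp only [subst, rename, ih]
    congr 2
    funext i
    rcases i with _ | i
    · simp [up, rename, lift]
    · simp only [up, rename_rename]
      congr 1
  | app M N ihM ihN => intro σ f; simp only [subst, rename, ihM, ihN]

theorem subst_rename (M : Lam) : ∀ (σ : ℕ → Lam) (f : ℕ → ℕ),
    (M.rename f).subst σ = M.subst (σ ∘ f) := by
  induction M with
  | var x => intros; rfl
  | lam M ih =>
    intro σ f
    simp only [subst, rename, ih]
    congr 2
    funext i
    rcases i with _ | i
    · simp [up, lift]
    · simp only [Function.comp]
      rw [lift_add 1 f i]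
      rfl
  | app M N ihM ihN => intro σ f; simp only [subst, rename, ihM, ihN]

theorem rename_inst (M N : Lam) (f : ℕ → ℕ) :
    (inst M N).rename f = inst (M.rename (lift 1 f)) (N.rename f) := by
  rw [inst, inst, rename_subst, subst_rename]
  congr 1
  funext i
  rcases i with _ | i
  · simp [lift]
  · simp only [Function.comp]
    rw [lift_add 1 f i]
    rfl

theorem CbnStep.rename {M N : Lam} (h : CbnStep M N) (f : ℕ → ℕ) :
    CbnStep (M.rename f) (N.rename f) := by
  induction h with
  | beta M N => rw [rename_inst]; exact .beta _ _
  | mu N _ ih => exact .mu _ ih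

/-! ### Head reduction, solvability and order -/

theorem HeadRed.lam {M N : Lam} (h : HeadRed M N) : HeadRed (lam M) (lam N) := by
  induction h with
  | refl => exact .refl
  | tail _ h ih => exact ih.tail (.xi h)

theorem lams_succ (n : ℕ) (M : Lam) : lams (n + 1) M = lam (lams n M) :=
  Function.iterate_succ_apply' lam n M

theorem lams_add (m n : ℕ) (M : Lam) : lams (m + n) M = lams m (lams n M) :=
  Function.iterate_add_apply lam m n M

theorem HeadRed.lams {M N : Lam} (h : HeadRed M N) (n : ℕ) : HeadRed (lams n M) (lams n N) := by
  induction n with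
  | zero => exact h
  | succ n ih => rw [lams_succ, lams_succ]; exact ih.lam

theorem CbnStep.deterministic {M N N' : Lam} (h : CbnStep M N) (h' : CbnStep M N') : N = N' := by
  induction h generalizing N' with
  | beta M N =>
    cases h' with
    | beta => rfl
    | mu _ h => cases h
  | mu N h ih =>
    cases h' with
    | beta => cases h
    | mu _ h' => rw [ih h']

theorem HeadStep.deterministic {M N N' : Lam} (h : HeadStep M N) (h' : HeadStep M N') : N = N' := by
  induction h generalizing N' with
  | cbn h =>
    cases h' with
    | cbn h' => exact h.deterministic h'
    | xi _ => cases h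
  | xi _ ih =>
    cases h' with
    | cbn h' => cases h'
    | xi h' => rw [ih h']

theorem HeadRed.lam_inv {M N : Lam} (h : HeadRed (Lam.lam M) N) :
    ∃ M', N = Lam.lam M' ∧ HeadRed M M' := by
  induction h with
  | refl => exact ⟨M, rfl, .refl⟩
  | tail _ h ih =>
    obtain ⟨M', rfl, hM⟩ := ih
    cases h with
    | cbn h => cases h
    | xi h => exact ⟨_, rfl, hM.tail h⟩

theorem HeadRed.lams_inv {n : ℕ} : ∀ {M N : Lam}, HeadRed (Lam.lams n M) N →
    ∃ M', N = Lam.lams n M' ∧ HeadRed M M' := by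
  induction n with
  | zero => exact fun h => ⟨_, rfl, h⟩
  | succ n ih =>
    intro M N h
    rw [lams_succ] at h
    obtain ⟨M₁, rfl, h₁⟩ := h.lam_inv
    obtain ⟨M₂, rfl, h₂⟩ := ih h₁
    exact ⟨M₂, (lams_succ n M₂).symm, h₂⟩

theorem solvable_of_headRed_lams {M N : Lam} {n : ℕ} (h : HeadRed M (lams n N))
    (hN : N.Solvable) : M.Solvable := by
  obtain ⟨⟨k, y, Ns⟩, hN⟩ := hN
  refine ⟨(n + k, y, Ns), ?_⟩
  rw [HasHnf, lams_add]
  exact h.trans (HeadRed.lams hN n)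

theorem le_order {M N : Lam} {n : ℕ} (h : HeadRed M (lams n N)) : (n : ℕ∞) ≤ M.order :=
  le_iSup₂_of_le (f := fun (k : ℕ) (_ : k ∈ {k : ℕ | ∃ N, HeadRed M (lams k N)}) => (k : ℕ∞))
    n ⟨N, h⟩ le_rfl

theorem exists_headRed_of_lt_order {M : Lam} {n : ℕ} (h : (n : ℕ∞) < M.order) :
    ∃ k, n < k ∧ ∃ N, HeadRed M (lams k N) := by
  rw [order, lt_iSup_iff] at h
  obtain ⟨k, h⟩ := h
  rw [lt_iSup_iff] at h
  obtain ⟨hk, h⟩ := h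
  exact ⟨k, by exact_mod_cast h, hk⟩

/-- A finite supremum of natural numbers is attained. -/
theorem exists_headRed_lams_of_order_eq {M : Lam} {n : ℕ} (h : M.order = n) :
    ∃ N, HeadRed M (lams n N) := by
  rcases n with _ | n
  · exact ⟨M, .refl⟩
  · obtain ⟨k, hk, N, hN⟩ := exists_headRed_of_lt_order (M := M) (n := n)
      (by rw [h]; exact_mod_cast Nat.lt_succ_self n)
    have := le_order hN
    rw [h] at this
    have hkn : k = n + 1 := le_antisymm (by exact_mod_cast this) hk
    exact ⟨N, hkn ▸ hN⟩

theorem UnsolvableOfOrder.exists_headRed {M : Lam} {n : ℕ} (h : M.UnsolvableOfOrder n) :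
    ∃ N, HeadRed M (lams n N) ∧ N.UnsolvableOfOrder 0 := by
  obtain ⟨N, hN⟩ := exists_headRed_lams_of_order_eq h.2
  refine ⟨N, hN, fun hs => h.1 (solvable_of_headRed_lams hN hs), ?_⟩
  by_contra h0
  -- A further abstraction uncovered in `N` would be one more than the order of `M` permits.
  obtain ⟨k, hk, N', hN'⟩ := exists_headRed_of_lt_order (M := N) (n := 0)
    (by simpa using pos_iff_ne_zero.mpr h0)
  have : HeadRed M (lams (n + k) N') := by
    rw [lams_add]; exact hN.trans (HeadRed.lams hN' n)
  have := le_order this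
  rw [h.2] at this
  have : n + k ≤ n := by exact_mod_cast this
  omega

theorem UnsolvableOfOrder.exists_headRed_lam {M : Lam} (h : M.UnsolvableOfOrder ⊤) :
    ∃ N, HeadRed M (lam N) ∧ N.UnsolvableOfOrder ⊤ := by
  obtain ⟨k, hk, N, hN⟩ := exists_headRed_of_lt_order (M := M) (n := 0) (by rw [h.2]; simp)
  obtain ⟨k, rfl⟩ := Nat.exists_eq_succ_of_ne_zero hk.ne'
  rw [Nat.succ_eq_add_one, lams_succ] at hN
  refine ⟨_, hN, fun hs => h.1 (solvable_of_headRed_lams (n := 1) hN hs), ?_⟩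
  rw [ENat.eq_top_iff_forall_ge]
  intro m
  obtain ⟨j, hj, N', hN'⟩ := exists_headRed_of_lt_order (M := M) (n := m)
    (by rw [h.2]; exact ENat.natCast_lt_top m)
  obtain ⟨j, rfl⟩ := Nat.exists_eq_succ_of_ne_zero (show j ≠ 0 by omega)
  rw [Nat.succ_eq_add_one, lams_succ] at hN'
  suffices ∃ N'', HeadRed (lams k N) (lams j N'') by
    obtain ⟨N'', h''⟩ := this
    exact le_trans (by exact_mod_cast Nat.lt_succ_iff.mp hj) (le_order h'')
  -- Head reduction is deterministic, so the two reducts lie on one path. Either the first reduces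
  -- to the one with more than `m` abstractions, or it comes later and still has them, since
  -- abstractions persist.
  rcases Relation.ReflTransGen.total_of_right_unique
    (r := HeadStep) (fun _ _ _ h h' => HeadStep.deterministic h h') hN hN' with h' | h'
  · obtain ⟨L, hL, hr⟩ := HeadRed.lam_inv h'
    cases hL
    exact ⟨N', hr⟩
  · obtain ⟨L, hL, hr⟩ := HeadRed.lam_inv h'
    cases hL
    obtain ⟨L', hL', _⟩ := HeadRed.lams_inv hr
    exact ⟨L', hL' ▸ .refl⟩

/-- The term `(λ x. λ y. x x) (λ x. λ y. x x)`, which reduces to `λ y` of itself. -/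
def Ogre : Lam :=
  app (lam (lam (app (var 1) (var 1)))) (lam (lam (app (var 1) (var 1))))

theorem cbnStep_ogre : CbnStep Ogre (lam Ogre) := .beta _ _

theorem headRed_ogre_lams (n : ℕ) : HeadRed Ogre (lams n Ogre) := by
  induction n with
  | zero => exact .refl
  | succ n ih =>
    refine ih.trans ?_
    rw [lams_add]
    exact HeadRed.lams (.single (.cbn cbnStep_ogre)) n

theorem eq_lams_of_headRed_ogre {N : Lam} (h : HeadRed Ogre N) : ∃ n, N = lams n Ogre := by
  have step : ∀ (n : ℕ) (N : Lam), HeadStep (lams n Ogre) N → N = lams (n + 1) Ogre := by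
    intro n
    induction n with
    | zero => exact fun N h => HeadStep.deterministic h (.cbn cbnStep_ogre)
    | succ n ih =>
      intro N h
      rw [lams_succ] at h
      cases h with
      | cbn h => cases h
      | xi h => rw [ih _ h, ← lams_succ]
  induction h with
  | refl => exact ⟨0, rfl⟩
  | tail _ h ih =>
    obtain ⟨n, rfl⟩ := ih
    exact ⟨n + 1, step n _ h⟩

theorem apps_var_ne (y : ℕ) (Ms : List Lam) :
    (∀ N, apps (var y) Ms ≠ lam N) ∧ ∀ N L, apps (var y) Ms ≠ app (lam N) L := by
  have : ∀ y (Ms : List Lam), (∀ N, apps (var y) Ms ≠ lam N) := by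
    intro y Ms
    induction Ms using List.reverseRecOn with
    | nil => simp [apps]
    | append_singleton Ms M _ => simp [apps, List.foldl_append]
  refine ⟨this y Ms, ?_⟩
  induction Ms using List.reverseRecOn with
  | nil => simp [apps]
  | append_singleton Ms M _ =>
    intro N L h
    simp only [apps, List.foldl_append, List.foldl_cons, List.foldl_nil, app.injEq] at h
    exact this y Ms N h.1

/-- All reducts are abstractions over the term itself, whose body is a head redex and so never a
variable applied to arguments. -/
theorem unsolvableOfOrder_ogre : Ogre.UnsolvableOfOrder ⊤ := by
  constructor
  · rintro ⟨⟨k, y, Ms⟩, h⟩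
    obtain ⟨n, hn⟩ := eq_lams_of_headRed_ogre h
    dsimp only at hn
    clear h
    induction k generalizing n with
    | zero =>
      rcases n with _ | n
      · exact (apps_var_ne y Ms).2 _ _ hn
      · rw [lams_succ] at hn; exact (apps_var_ne y Ms).1 _ hn
    | succ k ih =>
      rcases n with _ | n
      · rw [lams_succ] at hn; cases hn
      · rw [lams_succ, lams_succ] at hn
        exact ih n (lam.inj hn)
  · rw [ENat.eq_top_iff_forall_ge]
    exact fun m => le_order (headRed_ogre_lams m)

end Lam

/-! ### Trees -/

/-- The root of a tree always has a label, so the labels determine the number of children. -/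
theorem exists_children {T : List ℕ → Lam → Option Label} (hT : ∀ M, T [] M ≠ none)
    {Ms Ns : List Lam} (h : ∀ (i : ℕ) (p : List ℕ), Ms[i]?.bind (T p) = Ns[i]?.bind (T p)) :
    ∃ (k : ℕ) (Ms' Ns' : Fin k → Lam), Ms = List.ofFn Ms' ∧ Ns = List.ofFn Ns' ∧
      ∀ j p, T p (Ms' j) = T p (Ns' j) := by
  have hle : ∀ Ms Ns : List Lam, (∀ (i : ℕ) (p : List ℕ), Ms[i]?.bind (T p) = Ns[i]?.bind (T p)) →
      Ms.length ≤ Ns.length := by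
    intro Ms Ns h
    by_contra hlt
    have := h Ns.length []
    rw [List.getElem?_eq_getElem (by omega), List.getElem?_eq_none le_rfl] at this
    exact hT _ this
  have hl : Ms.length = Ns.length := le_antisymm (hle _ _ h) (hle _ _ fun i p => (h i p).symm)
  refine ⟨Ms.length, Ms.get, fun j => Ns.get (j.cast hl), (List.ofFn_get Ms).symm, ?_, ?_⟩
  · refine List.ext_getElem (by simp [hl]) fun i _ _ => by simp
  · intro j p
    have := h j p
    rw [List.getElem?_eq_getElem j.2, List.getElem?_eq_getElem (hl ▸ j.2)] at this
    simpa using this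

/-- The terms `M` and `N` have head normal forms with the same head, and with arguments that are
pairwise related by `S`. -/
def SimilarHnf (S : Lam → Lam → Prop) (M N : Lam) : Prop :=
  ∃ (n y k : ℕ) (Ms Ns : Fin k → Lam),
    Lam.HeadRed M (Lam.lams n (Lam.apps (.var y) (List.ofFn Ms))) ∧
    Lam.HeadRed N (Lam.lams n (Lam.apps (.var y) (List.ofFn Ns))) ∧ ∀ j, S (Ms j) (Ns j)

theorem LTAt_nil_ne_none (M : Lam) : LTAt [] M ≠ none := by
  rw [LTAt]; split_ifs <;> simp

theorem BTAt_nil_ne_none (M : Lam) : BTAt [] M ≠ none := by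
  rw [BTAt]; split_ifs <;> simp

/-- The trees are read off chosen head normal forms, and those choices serve as witnesses;
uniqueness of head normal forms plays no role. -/
theorem levyLongoTree_cases {M N : Lam} (h : levyLongoTree M = levyLongoTree N) :
    SimilarHnf (fun M N => levyLongoTree M = levyLongoTree N) M N ∨
    (M.UnsolvableOfOrder ⊤ ∧ N.UnsolvableOfOrder ⊤) ∨
    ∃ n : ℕ, M.UnsolvableOfOrder n ∧ N.UnsolvableOfOrder n := by
  have hnil := congrFun h []
  simp only [levyLongoTree, LTAt] at hnil
  by_cases hM : M.Solvable <;> by_cases hN : N.Solvable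
  · left
    have hc : ∀ (i : ℕ) (p : List ℕ),
        hM.choose.2.2[i]?.bind (LTAt p) = hN.choose.2.2[i]?.bind (LTAt p) := by
      intro i p
      have := congrFun h (i :: p)
      simpa only [levyLongoTree, LTAt, dif_pos hM, dif_pos hN] using this
    obtain ⟨k, Ms, Ns, h₁, h₂, h₃⟩ := exists_children LTAt_nil_ne_none hc
    simp only [dif_pos hM, dif_pos hN, Option.some.injEq, Label.head.injEq] at hnil
    have hsM := hM.choose_spec
    have hsN := hN.choose_spec
    rw [Lam.HasHnf, h₁] at hsM
    rw [Lam.HasHnf, h₂, ← hnil.1, ← hnil.2] at hsN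
    exact ⟨_, _, k, Ms, Ns, hsM, hsN, fun j => funext (h₃ j)⟩
  · rw [dif_pos hM, dif_neg hN] at hnil
    split_ifs at hnil <;> simp at hnil
  · rw [dif_neg hM, dif_pos hN] at hnil
    split_ifs at hnil <;> simp at hnil
  · right
    rw [dif_neg hM, dif_neg hN] at hnil
    by_cases hoM : M.order = ⊤ <;> by_cases hoN : N.order = ⊤
    · exact Or.inl ⟨⟨hM, hoM⟩, ⟨hN, hoN⟩⟩
    · rw [if_pos hoM, if_neg hoN] at hnil; simp at hnil
    · rw [if_neg hoM, if_pos hoN] at hnil; simp at hnil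
    · rw [if_neg hoM, if_neg hoN] at hnil
      simp only [Option.some.injEq, Label.bot.injEq] at hnil
      exact Or.inr ⟨M.order.toNat, ⟨hM, (ENat.natCast_toNat hoM).symm⟩,
        ⟨hN, by rw [hnil]; exact (ENat.natCast_toNat hoN).symm⟩⟩

theorem levyLongoTree_eq_of_order_top {M N : Lam} (hM : M.UnsolvableOfOrder ⊤)
    (hN : N.UnsolvableOfOrder ⊤) : levyLongoTree M = levyLongoTree N := by
  funext p
  cases p <;> simp [levyLongoTree, LTAt, hM.1, hN.1, hM.2, hN.2]

theorem boehmTree_cases {M N : Lam} (h : boehmTree M = boehmTree N) :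
    SimilarHnf (fun M N => boehmTree M = boehmTree N) M N ∨ (¬ M.Solvable ∧ ¬ N.Solvable) := by
  have hnil := congrFun h []
  simp only [boehmTree, BTAt] at hnil
  by_cases hM : M.Solvable <;> by_cases hN : N.Solvable
  · left
    have hc : ∀ (i : ℕ) (p : List ℕ),
        hM.choose.2.2[i]?.bind (BTAt p) = hN.choose.2.2[i]?.bind (BTAt p) := by
      intro i p
      have := congrFun h (i :: p)
      simpa only [boehmTree, BTAt, dif_pos hM, dif_pos hN] using this
    obtain ⟨k, Ms, Ns, h₁, h₂, h₃⟩ := exists_children BTAt_nil_ne_none hc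
    simp only [dif_pos hM, dif_pos hN, Option.some.injEq, Label.head.injEq] at hnil
    have hsM := hM.choose_spec
    have hsN := hN.choose_spec
    rw [Lam.HasHnf, h₁] at hsM
    rw [Lam.HasHnf, h₂, ← hnil.1, ← hnil.2] at hsN
    exact ⟨_, _, k, Ms, Ns, hsM, hsN, fun j => funext (h₃ j)⟩
  · rw [dif_pos hM, dif_neg hN] at hnil; simp at hnil
  · rw [dif_neg hM, dif_pos hN] at hnil; simp at hnil
  · exact Or.inr ⟨hM, hN⟩

/-! ### Contexts and contextual closures -/

section Fill

variable {n : ℕ} {Fs Gs : Fin n → Abs}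

theorem PCtx.ctxClosure_fill (hW : MapClosed W) (h : ∀ j, CtxClosure W (Fs j).body (Gs j).body)
    (C : PCtx 0 n) : CtxClosure W (C.fill Fin.elim0 Fs) (C.fill Fin.elim0 Gs) := by
  induction C with
  | const P => exact .refl P
  | hole i => exact i.elim0
  | holeApp j b => exact .app b (h j)
  | input a bs C ih => exact .inp _ _ (ih.map hW _)
  | par C D ihC ihD => exact .par ihC ihD
  | res x C ih => exact .nu (ih.map hW _)
  | repInput a bs C ih => exact .rep _ _ (ih.map hW _)
  | absApp x C b ih => exact .app b (ih.map hW _)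

theorem PCtx.guardedClosure_fill (hW : MapClosed W)
    (h : ∀ j, GuardedClosure W (Fs j).body (Gs j).body) (C : PCtx 0 n) :
    GuardedClosure W (C.fill Fin.elim0 Fs) (C.fill Fin.elim0 Gs) := by
  induction C with
  | const P => exact .refl P
  | hole i => exact i.elim0
  | holeApp j b => exact .app b (h j)
  | input a bs C ih => exact .inp _ _ (ih.ctxClosure.map hW _)
  | par C D ihC ihD => exact .par ihC ihD
  | res x C ih => exact .nu (ih.map hW _)
  | repInput a bs C ih => exact .rep _ _ (ih.ctxClosure.map hW _)
  | absApp x C b ih => exact .app b (ih.map hW _)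

theorem PCtx.Guarded.guardedClosure_fill (hW : MapClosed W)
    (h : ∀ j, CtxClosure W (Fs j).body (Gs j).body) {C : PCtx 0 n} (hC : C.Guarded) :
    GuardedClosure W (C.fill Fin.elim0 Fs) (C.fill Fin.elim0 Gs) := by
  induction C with
  | const P => exact .refl P
  | hole i => exact i.elim0
  | holeApp j b => exact hC.elim
  | input a bs C ih => exact .inp _ _ ((C.ctxClosure_fill hW h).map hW _)
  | par C D ihC ihD => exact .par (ihC hC.1) (ihD hC.2)
  | res x C ih => exact .nu ((ih hC).map hW _)
  | repInput a bs C ih => exact .rep _ _ ((C.ctxClosure_fill hW h).map hW _)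
  | absApp x C b ih => exact .app b ((ih hC).map hW _)

theorem FCtx.guardedClosure_fill (hW : MapClosed W)
    (h : ∀ j, GuardedClosure W (Fs j).body (Gs j).body) (C : FCtx 0 n) :
    GuardedClosure W (C.fill Fin.elim0 Fs).body (C.fill Fin.elim0 Gs).body := by
  cases C with
  | const F => exact .refl _
  | hole j => exact h j
  | abs x C => exact (C.guardedClosure_fill hW h).map hW _

theorem FCtx.Guarded.guardedClosure_fill (hW : MapClosed W)
    (h : ∀ j, CtxClosure W (Fs j).body (Gs j).body) {C : FCtx 0 n} (hC : C.Guarded) :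
    GuardedClosure W (C.fill Fin.elim0 Fs).body (C.fill Fin.elim0 Gs).body := by
  cases C with
  | const F => exact .refl _
  | hole j => exact hC.elim
  | abs x C => exact (PCtx.Guarded.guardedClosure_fill hW h hC).map hW _

theorem PCtx.fill_plug {m k : ℕ} (Ps : Fin m → Proc) (Hs : Fin k → Abs) (Cs : Fin n → FCtx m k)
    (C : PCtx m n) : (C.plug Cs).fill Ps Hs = C.fill Ps fun j => (Cs j).fill Ps Hs := by
  induction C with
  | holeApp j b =>
    simp only [plug, fill, ofApp]
    cases Cs j <;> rfl
  | _ => simp_all [plug, fill]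

theorem FCtx.fill_plug {m k : ℕ} (Ps : Fin m → Proc) (Hs : Fin k → Abs) (Cs : Fin n → FCtx m k)
    (C : FCtx m n) : (C.plug Cs).fill Ps Hs = C.fill Ps fun j => (Cs j).fill Ps Hs := by
  cases C with
  | const F => rfl
  | hole j => rfl
  | abs x C => simp only [plug, fill, PCtx.fill_plug]

end Fill

/-! ### Encodings -/

namespace Encoding

variable (E : Encoding)

/-- Both sides are built by adding a last argument through the application context, hence the
induction from the right end of the list. -/
theorem enc_apps_var (y : ℕ) : ∀ {n : ℕ} (Ms : Fin n → Lam),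
    E.enc (Lam.apps (.var y) (List.ofFn Ms)) =
      (E.varCtx y n).fill Fin.elim0 fun j => E.enc (Ms j) := by
  intro n
  induction n with
  | zero => intro Ms; exact E.enc_var y
  | succ n ih =>
    intro Ms
    have h : Lam.apps (.var y) (List.ofFn Ms) =
        .app (Lam.apps (.var y) (List.ofFn fun j : Fin n => Ms j.castSucc)) (Ms (Fin.last n)) := by
      rw [List.ofFn_succ', List.concat_eq_append, Lam.apps, List.foldl_append]
      rfl
    rw [h, E.enc_app, ih, varCtx, FCtx.fill_plug]
    congr 1
    funext j
    refine Fin.cases ?_ (fun j => ?_) j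
    · exact (FCtx.fill_plug Fin.elim0 (fun j => E.enc (Ms j)) (fun j => .hole j.castSucc)
        (E.varCtx y n)).symm
    · obtain rfl : j = 0 := Subsingleton.elim _ _
      simp [FCtx.fill]

/-- A variable free in neither body can name both binders, so the two encodings use the same
abstraction context. -/
theorem exists_enc_lam (M N : Lam) : ∃ (x : ℕ) (f : ℕ → ℕ),
    E.enc (.lam M) = (E.lamCtx x).fill Fin.elim0 ![E.enc (M.rename f)] ∧
    E.enc (.lam N) = (E.lamCtx x).fill Fin.elim0 ![E.enc (N.rename f)] := by
  obtain ⟨x, hx⟩ := exists_fresh (M.fv_finite.union N.fv_finite)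
  have hM : x + 1 ∉ M.fv := fun h => by have := hx _ (Or.inl h); omega
  have hN : x + 1 ∉ N.fv := fun h => by have := hx _ (Or.inr h); omega
  exact ⟨x, unbindNames [x], by rw [Lam.lam_eq_abs hM, E.enc_abs],
    by rw [Lam.lam_eq_abs hN, E.enc_abs]⟩

variable {E}

theorem le_of_cbnStep (hle : le.IsPrecongruence) (hbeta : ValidatesBeta E le.inv) {M N : Lam}
    (h : Lam.CbnStep M N) : le.abs (E.enc N) (E.enc M) := by
  induction h with
  | beta M N => exact hbeta M N
  | mu N _ ih =>
    rw [E.enc_app, E.enc_app]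
    refine hle.fill _ fun j => ?_
    refine Fin.cases ih (fun j => ?_) j
    simpa using hle.refl_abs _

/-- Naming a binder renames the body, and ≤ need not be closed under substitution. The renaming is
therefore done on λ-terms, where head steps are stable, and the induction quantifies over it. -/
theorem le_of_headStep (hle : le.IsPrecongruence) (hbeta : ValidatesBeta E le.inv) {M N : Lam}
    (h : Lam.HeadStep M N) : ∀ f, le.abs (E.enc (N.rename f)) (E.enc (M.rename f)) := by
  induction h with
  | cbn h => exact fun f => le_of_cbnStep hle hbeta (h.rename f)
  | @xi M N _ ih =>
    intro f
    obtain ⟨x, g, h₁, h₂⟩ := E.exists_enc_lam (M.rename (lift 1 f)) (N.rename (lift 1 f))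
    rw [Lam.rename, Lam.rename, h₁, h₂, Lam.rename_rename, Lam.rename_rename]
    exact hle.fill _ fun j => by simpa using ih _

theorem le_of_headRed (hle : le.IsPrecongruence) (hbeta : ValidatesBeta E le.inv) {M N : Lam}
    (h : Lam.HeadRed M N) : le.abs (E.enc N) (E.enc M) := by
  induction h with
  | refl => exact hle.refl_abs _
  | tail _ h ih =>
    have := le_of_headStep hle hbeta h id
    rw [Lam.rename_id, Lam.rename_id] at this
    exact hle.trans_abs _ _ _ this ih

theorem eqv_lam (heqv : eqv.IsCongruence) (hle : le.IsPrecongruence)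
    (hupto : ValidatesUpTo eqv le) {M N : Lam} (h : eqv.abs (E.enc M) (E.enc N)) :
    eqv.abs (E.enc (.lam M)) (E.enc (.lam N)) := by
  obtain ⟨x, f, h₁, h₂⟩ := E.exists_enc_lam M N
  rw [h₁, h₂, E.enc_rename, E.enc_rename]
  exact heqv.toIsPrecongruence.fill _ fun j => by simpa using heqv.abs_map hle hupto h _

theorem eqv_lams (heqv : eqv.IsCongruence) (hle : le.IsPrecongruence)
    (hupto : ValidatesUpTo eqv le) {M N : Lam} (h : eqv.abs (E.enc M) (E.enc N)) (n : ℕ) :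
    eqv.abs (E.enc (Lam.lams n M)) (E.enc (Lam.lams n N)) := by
  induction n with
  | zero => exact h
  | succ n ih => rw [Lam.lams_succ, Lam.lams_succ]; exact eqv_lam heqv hle hupto ih

/-- Holes that are already guarded stay so in any surrounding context; guardedness of the
abstraction context is not needed. -/
theorem guardedClosure_lam (hW : MapClosed W) {M N : Lam}
    (h : GuardedClosure W (E.enc M).body (E.enc N).body) :
    GuardedClosure W (E.enc (.lam M)).body (E.enc (.lam N)).body := by
  obtain ⟨x, f, h₁, h₂⟩ := E.exists_enc_lam M N
  rw [h₁, h₂, E.enc_rename, E.enc_rename]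
  exact FCtx.guardedClosure_fill hW (fun j => by simpa [Abs.map] using h.map hW _) _

theorem guardedClosure_lam_of_guarded (hW : MapClosed W) (hE : ∀ x, (E.lamCtx x).Guarded)
    {M N : Lam} (h : CtxClosure W (E.enc M).body (E.enc N).body) :
    GuardedClosure W (E.enc (.lam M)).body (E.enc (.lam N)).body := by
  obtain ⟨x, f, h₁, h₂⟩ := E.exists_enc_lam M N
  rw [h₁, h₂, E.enc_rename, E.enc_rename]
  exact (hE x).guardedClosure_fill hW fun j => by simpa [Abs.map] using h.map hW _

theorem guardedClosure_lams (hW : MapClosed W) {M N : Lam}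
    (h : GuardedClosure W (E.enc M).body (E.enc N).body) (n : ℕ) :
    GuardedClosure W (E.enc (Lam.lams n M)).body (E.enc (Lam.lams n N)).body := by
  induction n with
  | zero => exact h
  | succ n ih => rw [Lam.lams_succ, Lam.lams_succ]; exact guardedClosure_lam hW ih

variable (E) in
/-- The instances of the encodings of terms related by `S`. -/
def BodyRel (S : Lam → Lam → Prop) (P Q : Proc) : Prop :=
  ∃ M N f, S M N ∧ P = (E.enc M).body.map f ∧ Q = (E.enc N).body.map f

variable {S : Lam → Lam → Prop}

theorem BodyRel.mapClosed : MapClosed (E.BodyRel S) := by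
  rintro _ _ ⟨M, N, f, h, rfl, rfl⟩ g
  exact ⟨M, N, g ∘ f, h, Proc.map_map _ _ _, Proc.map_map _ _ _⟩

theorem BodyRel.of_rel {M N : Lam} (h : S M N) :
    CtxClosure (E.BodyRel S) (E.enc M).body (E.enc N).body :=
  .hole ⟨M, N, id, h, (Proc.map_id _).symm, (Proc.map_id _).symm⟩

/-- A symmetric relation on terms is contained in the congruence if the terms that it relates reduce
to terms whose encodings are related by guarded contexts. -/
theorem eqv_of_guardedClosure (heqv : eqv.IsCongruence) (hle : le.IsPrecongruence)
    (hexp : IsExpansion le.proc) (hupto : ValidatesUpTo eqv le) (hbeta : ValidatesBeta E le.inv)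
    (hsymm : ∀ M N, S M N → S N M)
    (hS : ∀ M N, S M N → eqv.abs (E.enc M) (E.enc N) ∨ ∃ M' N', Lam.HeadRed M M' ∧
      Lam.HeadRed N N' ∧ GuardedClosure (E.BodyRel S) (E.enc M').body (E.enc N').body)
    {M N : Lam} (h : S M N) : eqv.abs (E.enc M) (E.enc N) := by
  have hW : MapClosed (E.BodyRel S) := BodyRel.mapClosed
  -- The same-tree terms in the holes re-enter the candidate here: head reduction exposes a guarded
  -- context, at the cost of an expansion.
  have key : ∀ M N, S M N → eqv.abs (E.enc M) (E.enc N) ∨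
      ∀ f, GuardedExpansion le (E.BodyRel S) ((E.enc M).body.map f) ((E.enc N).body.map f) := by
    intro M N h
    refine (hS M N h).imp_right ?_
    rintro ⟨M', N', hM, hN, hG⟩ f
    exact ⟨_, _, hG.map hW f, .of_abs hle (le_of_headRed hle hbeta hM) f,
      .of_abs hle (le_of_headRed hle hbeta hN) f⟩
  have hcand : IsUpToCandidate eqv le (GuardedExpansion le (E.BodyRel S)) := by
    refine GuardedExpansion.isUpToCandidate hle hexp hW ?_
    rintro _ _ ⟨M, N, f, h, rfl, rfl⟩
    refine (key M N h).imp (fun h => heqv.body hle hupto h f) fun h g => ?_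
    rw [Proc.map_map, Proc.map_map]
    exact h _
  have hsymmW : ∀ P Q, E.BodyRel S P Q → E.BodyRel S Q P := by
    rintro _ _ ⟨M, N, f, h, rfl, rfl⟩
    exact ⟨N, M, f, hsymm M N h, rfl, rfl⟩
  rcases key M N h with h | h
  · exact h
  · refine heqv.abs_of_body fun f => hupto _ ?_ hcand _ _ (h f)
    rintro P Q ⟨X, Y, hXY, hX, hY⟩
    exact ⟨Y, X, hXY.symm hsymmW, hY, hX⟩

theorem guardedClosure_of_similarHnf (hvar : ∀ x n, (E.varCtx x n).Guarded) {M N : Lam}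
    (h : SimilarHnf S M N) : ∃ M' N', Lam.HeadRed M M' ∧ Lam.HeadRed N N' ∧
      GuardedClosure (E.BodyRel S) (E.enc M').body (E.enc N').body := by
  obtain ⟨n, y, k, Ms, Ns, hM, hN, hS⟩ := h
  refine ⟨_, _, hM, hN, guardedClosure_lams BodyRel.mapClosed ?_ n⟩
  rw [E.enc_apps_var, E.enc_apps_var]
  exact (hvar y k).guardedClosure_fill BodyRel.mapClosed fun j => BodyRel.of_rel (hS j)

theorem eqv_lams_Omega (heqv : eqv.IsCongruence) (hle : le.IsPrecongruence)
    (hsub : AgentRel.Sub le.inv eqv) (hupto : ValidatesUpTo eqv le)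
    (hbeta : ValidatesBeta E le.inv)
    (hzero : ∀ M : Lam, M.UnsolvableOfOrder 0 → eqv.abs (E.enc M) (E.enc Lam.Omega))
    {M : Lam} {n : ℕ} (h : M.UnsolvableOfOrder n) :
    eqv.abs (E.enc M) (E.enc (Lam.lams n Lam.Omega)) := by
  obtain ⟨N, hN, h0⟩ := h.exists_headRed
  exact heqv.trans_abs _ _ _ (hsub.2 _ _ (le_of_headRed hle hbeta hN))
    (eqv_lams heqv hle hupto (hzero N h0) n)

end Encoding

end TreesPi

open TreesPi
theorem theoremt (E : Encoding) (eqv le : AgentRel)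
    (heqv : eqv.IsCongruence) (hle : le.IsPrecongruence)
    (hsub : AgentRel.Sub le.inv eqv)
    (hexp : IsExpansion le.proc)
    (hupto : ValidatesUpTo eqv le)
    (hvar : ∀ x n, (E.varCtx x n).Guarded)
    (hbeta : ValidatesBeta E le.inv)
    (hzero : ∀ M : Lam, M.UnsolvableOfOrder 0 → eqv.abs (E.enc M) (E.enc Lam.Omega)) :
    ((∀ x, (E.lamCtx x).Guarded) → CompleteFor E eqv levyLongoTree) ∧
    ((∀ M : Lam, M.UnsolvableOfOrder ⊤ → eqv.abs (E.enc M) (E.enc Lam.Omega)) →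
      CompleteFor E eqv boehmTree) := by
  have hfin : ∀ {M : Lam} {n : ℕ}, M.UnsolvableOfOrder n →
      eqv.abs (E.enc M) (E.enc (Lam.lams n Lam.Omega)) :=
    Encoding.eqv_lams_Omega heqv hle hsub hupto hbeta hzero
  constructor
  · intro hlam M N h
    refine Encoding.eqv_of_guardedClosure heqv hle hexp hupto hbeta
      (S := fun M N => levyLongoTree M = levyLongoTree N) (fun _ _ => Eq.symm) ?_ h
    intro M N h
    rcases levyLongoTree_cases h with h | ⟨hM, hN⟩ | ⟨n, hM, hN⟩
    · exact Or.inr (Encoding.guardedClosure_of_similarHnf hvar h)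
    -- Order ∞ never reaches a head normal form, but each side reduces to an abstraction whose body
    -- again has order ∞. The guarded abstraction context thus makes the coinduction productive.
    · right
      obtain ⟨M', hM', hoM⟩ := hM.exists_headRed_lam
      obtain ⟨N', hN', hoN⟩ := hN.exists_headRed_lam
      refine ⟨_, _, hM', hN', Encoding.guardedClosure_lam_of_guarded Encoding.BodyRel.mapClosed
        hlam (Encoding.BodyRel.of_rel (levyLongoTree_eq_of_order_top hoM hoN))⟩
    · exact Or.inl (heqv.trans_abs _ _ _ (hfin hM) (heqv.symm_abs _ _ (hfin hN)))
  · intro htop M N h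
    refine Encoding.eqv_of_guardedClosure heqv hle hexp hupto hbeta
      (S := fun M N => boehmTree M = boehmTree N) (fun _ _ => Eq.symm) ?_ h
    -- With O for `Ogre`, λx.Ω ≍ λx.O ≍ O ≍ Ω: the outer links come from the hypothesis on order ∞,
    -- the middle one from O reducing to λx.O.
    have hlamOmega : eqv.abs (E.enc (.lam Lam.Omega)) (E.enc Lam.Omega) := by
      have ho := htop _ Lam.unsolvableOfOrder_ogre
      refine heqv.trans_abs _ _ _
        (Encoding.eqv_lam heqv hle hupto (heqv.symm_abs _ _ ho)) ?_
      refine heqv.trans_abs _ _ _ (heqv.symm_abs _ _ (hsub.2 _ _ ?_)) ho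
      exact Encoding.le_of_cbnStep hle hbeta Lam.cbnStep_ogre
    have hlamsOmega : ∀ n, eqv.abs (E.enc (Lam.lams n Lam.Omega)) (E.enc Lam.Omega) := by
      intro n
      induction n with
      | zero => exact heqv.refl_abs _
      | succ n ih =>
        rw [Lam.lams_succ]
        exact heqv.trans_abs _ _ _ (Encoding.eqv_lam heqv hle hupto ih) hlamOmega
    have hunsolv : ∀ M : Lam, ¬ M.Solvable → eqv.abs (E.enc M) (E.enc Lam.Omega) := by
      intro M hM
      by_cases ho : M.order = ⊤
      · exact htop M ⟨hM, ho⟩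
      · exact heqv.trans_abs _ _ _ (hfin ⟨hM, (ENat.natCast_toNat ho).symm⟩) (hlamsOmega _)
    intro M N h
    rcases boehmTree_cases h with h | ⟨hM, hN⟩
    · exact Or.inr (Encoding.guardedClosure_of_similarHnf hvar h)
    · exact Or.inl (heqv.trans_abs _ _ _ (hunsolv M hM) (heqv.symm_abs _ _ (hunsolv N hN)))
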